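/- **Setting.** Let $(X,d)$ be a metric space with positive Borel measures $\mu$ and $\nu$, and let $E\subset X$ be $\nu$-measurable. Balls $B=B(x,r)=\{y\in X: d(x,y)<r\}$ come with a fixed centre and radius, $\lambda B:=B(x,\lambda r)$, and $u_{B,\mu}:=\frac1{\mu(B)}\int_B u\,d\mu$. $L^s_{\rm loc}(X,\mu)$ is the space of functions belonging to $L^s(B,\mu)$ for every ball $B\subset X$. Let $u:X\to[-\infty,\infty]$ be in $L^1_{\rm loc}(X,\mu)$, let $g:X\to[0,\infty]$ be in $L^p_{\rm loc}(X,\mu)$, and let $1\le p<q<\infty$, $\alpha>0$, $\lambda\ge1$. We consider the following conditions, with positive constants $C_\mu,C_\nu,C_\delta,C_P,\delta$. - Doubling on a ball $B(x,r)$: $0<\mu(B(x,2r))\le C_\mu\,\mu(B(x,r))<\infty$ and $0<\nu(B(x,2r))\le C_\nu\,\nu(B(x,r))<\infty$. - Decay condition up to $r_0$: $\displaystyle\frac{\nu(B(x,r'))}{\nu(B(x,r))}\le C_\delta\Bigl(\frac{r'}{r}\Bigr)^{\delta}$ for all $x\in E$ and $0<r'<r\le r_0$. - Lebesgue points: $u(x)=\lim_{r\to0}u_{B(x,r),\mu}$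 for $\nu$-a.e. $x\in E$. - $p$-Poincaré inequality on a ball $B$: $$\frac1{\mu(B)}\int_B|u-u_{B,\mu}|\,d\mu\le C_P\,[\operatorname{diam}(B)]^\alpha\Bigl(\frac1{\mu(\lambda B)}\int_{\lambda B}g^p\,d\mu\Bigr)^{1/p}\qquad(\mathrm{P})$$ (the right-hand side being $0$ if $\mu(\lambda B)=\infty$). - Truncation property on a family of balls: for all real $l<k$, (P) holds on these balls, with the same constant $C_P$, also with $u$ and $g$ replaced by $\max\{l,\min\{u,k\}\}$ and $g\chi_{\{l<u<k\}}$. For $A\subset X$ and $r>0$ let $$\Theta_{q,\lambda}(r;A):=\sup_{0<\rho\le r}\ \sup_{x\in A}\frac{\rho^\alpha\,\nu(B(x,\rho))^{1/q}}{\mu(B(x,\lambda\rho))^{1/p}}\in[0,\infty].$$ **Theorem, part 1.** There is a constant $C>0$, depending only on $p,q,\alpha,\lambda,\delta,C_\mu,C_\nu,C_\delta,C_P$, such that the following holds. Let $r_0>0$. Assume that the doubling conditions and (P) hold on all balls centred in $E$ with radius at most $r_0$, that $\nu$ satisfies the decay condition up to $r_0$, that $u$ has the above Lebesgue point property, and that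 $\Theta_{q,\lambda}(r_0;E)<\infty$. (i) For all $1\le q'<q$ and all balls $B=B(x,r)$ with $x\in E$ and $0<10\lambda r\le r_0$, $$\Bigl(\int_{B\cap E}|u-u_{B,\mu}|^{q'}\,d\nu\Bigr)^{1/q'}\le C\,\Theta_{q,\lambda}(r;E)\,\frac{\nu(B\cap E)^{1/q'-1/q}}{q-q'}\Bigl(\int_{2\lambda B}g^p\,d\mu\Bigr)^{1/p}.$$ In particular, $u\in L^{q'}(B\cap E,\nu)$ for all such balls $B$. (ii) If $(u,g)$ also has the truncation property on all balls centred in $E$ with radius at most $r_0$, then for all balls $B$ as in (i), $$\Bigl(\int_{B\cap E}|u-u_{B,\mu}|^{q}\,d\nu\Bigr)^{1/q}\le C\,\Theta_{q,\lambda}(r;E)\Bigl(\int_{2\lambda B}g^p\,d\mu\Bigr)^{1/p},$$ and $u\in L^q(B\cap E,\nu)$. **Theorem, part 2.** Let $1\le q'\le q$ and $0<a<1$. There is a constant $C'>0$, depending only on $p,q,q',\alpha,\lambda,a,C_\mu,C_\nu,C_P$, such that the following holds. Assume that $E$ is uniformly perfect with constant $a$, in the sense that $(E\cap B(x,r))\setminus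 B(x,ar)\neq\emptyset$ for all $x\in E$ and all $r>0$, that the doubling conditions and (P) hold on all balls centred in $E$ (of any radius), and that $u$ has the above Lebesgue point property. If $q'<q$, or if $(u,g)$ has the truncation property on all balls centred in $E$, then for all balls $B=B(x,r)$ with $x\in E$ and $r>0$, $$\Bigl(\int_{B\cap E}|u-u_{B,\mu}|^{q'}\,d\nu\Bigr)^{1/q'}\le C'\,\nu(B\cap E)^{1/q'-1/q}\,\Theta_{q,\lambda}(r;E\cap B)\Bigl(\int_{2\lambda B}g^p\,d\mu\Bigr)^{1/p},$$ where $0\cdot\infty:=0$ on the right-hand side. -/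

import Mathlib

open MeasureTheory Metric Set Filter Topology
open scoped ENNReal

noncomputable section

namespace TwoWeight

/-- The extended real-valued function `u` belongs to `L^s(S, μ)`, where `1 ≤ s < ∞`. -/
def MemLpOn {X : Type*} [MeasurableSpace X] (μ : Measure X) (s : ℝ) (S : Set X)
    (u : X → EReal) : Prop :=
  AEMeasurable u (μ.restrict S) ∧ ∫⁻ y in S, (u y).abs ^ s ∂μ < ∞

/-- `u ∈ L¹_loc(X, μ)`: the function is integrable on every ball of `X`. -/
def MemL1Loc {X : Type*} [MetricSpace X] [MeasurableSpace X] (μ : Measure X)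
    (u : X → EReal) : Prop :=
  ∀ (x : X) (r : ℝ), 0 < r → MemLpOn μ 1 (ball x r) u

/-- `g ∈ L^p_loc(X, μ)` for a nonnegative function `g`, again meaning on every ball of `X`. -/
def MemLpLoc {X : Type*} [MetricSpace X] [MeasurableSpace X] (μ : Measure X) (p : ℝ)
    (g : X → ℝ≥0∞) : Prop :=
  ∀ (x : X) (r : ℝ), 0 < r →
    AEMeasurable g (μ.restrict (ball x r)) ∧ ∫⁻ y in ball x r, g y ^ p ∂μ < ∞

/-- The integral average `u_{B,μ}` over the open ball `B = B(x,r)`. It is used only for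
functions that are integrable on `B`, hence finite almost everywhere there. -/
def ballAvg {X : Type*} [MetricSpace X] [MeasurableSpace X] (μ : Measure X)
    (u : X → EReal) (x : X) (r : ℝ) : ℝ :=
  ⨍ y in ball x r, (u y).toReal ∂μ

/-- The doubling condition `0 < μ(B(x,2r)) ≤ C μ(B(x,r)) < ∞` for the ball `B(x,r)`. -/
def DoublingAt {X : Type*} [MetricSpace X] [MeasurableSpace X] (μ : Measure X) (C : ℝ)
    (x : X) (r : ℝ) : Prop :=
  0 < μ (ball x (2 * r)) ∧
    μ (ball x (2 * r)) ≤ ENNReal.ofReal C * μ (ball x r) ∧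
    ENNReal.ofReal C * μ (ball x r) < ∞

/-- The `p`-Poincaré inequality of order `α` with dilation `lam` and constant `C`, for the pair
`(u, g)` on the single ball `B = B(x,r)`:
`⨍_B |u - u_B| dμ ≤ C diam(B)^α (⨍_{lam B} g^p dμ)^{1/p}`. -/
def PoincareAt {X : Type*} [MetricSpace X] [MeasurableSpace X] (μ : Measure X)
    (p α lam C : ℝ) (u : X → EReal) (g : X → ℝ≥0∞) (x : X) (r : ℝ) : Prop :=
  ⨍⁻ y in ball x r, (u y - (ballAvg μ u x r : EReal)).abs ∂μ ≤
    ENNReal.ofReal (C * diam (ball x r) ^ α) *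
      (⨍⁻ y in ball x (lam * r), g y ^ p ∂μ) ^ (1 / p)

/-- The truncation `max {l, min {u, k}}`. -/
def trunc {X : Type*} (u : X → EReal) (l k : ℝ) : X → EReal :=
  fun y => max (l : EReal) (min (u y) (k : EReal))

/-- The truncated gradient `g χ_{l < u < k}`. -/
def truncGrad {X : Type*} (u : X → EReal) (g : X → ℝ≥0∞) (l k : ℝ) : X → ℝ≥0∞ :=
  indicator {y | (l : EReal) < u y ∧ u y < (k : EReal)} g

/-- The Poincaré inequality on the ball `B(x,r)` for all truncations of the pair `(u, g)`. -/
def TruncPoincareAt {X : Type*} [MetricSpace X] [MeasurableSpace X] (μ : Measure X)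
    (p α lam C : ℝ) (u : X → EReal) (g : X → ℝ≥0∞) (x : X) (r : ℝ) : Prop :=
  ∀ l k : ℝ, l < k → PoincareAt μ p α lam C (trunc u l k) (truncGrad u g l k) x r

/-- At `ν`-almost every point of `E`, the value of `u` is the limit of its `μ`-averages over
balls shrinking to the point. -/
def LebesguePoints {X : Type*} [MetricSpace X] [MeasurableSpace X] (μ ν : Measure X)
    (E : Set X) (u : X → EReal) : Prop :=
  ∀ᵐ x ∂ν, x ∈ E →
    Tendsto (fun r : ℝ => (ballAvg μ u x r : EReal)) (𝓝[>] (0 : ℝ)) (𝓝 (u x))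

/-- The local Poincaré constant on `E`,
`sup_{0<ρ≤r} sup_{x∈E} ρ^α ν(B(x,ρ))^{1/q} / μ(B(x,lam ρ))^{1/p}`, with values in `[0,∞]`. -/
def Theta {X : Type*} [MetricSpace X] [MeasurableSpace X] (μ ν : Measure X) (E : Set X)
    (p q α lam r : ℝ) : ℝ≥0∞ :=
  ⨆ ρ ∈ Ioc (0 : ℝ) r, ⨆ x ∈ E,
    ENNReal.ofReal (ρ ^ α) * ν (ball x ρ) ^ (1 / q) / μ (ball x (lam * ρ)) ^ (1 / p)

/-- `(∫_{B ∩ E} |u - u_{B,μ}|^s dν)^{1/s}` for `B = B(x,r)`. -/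
def oscNorm {X : Type*} [MetricSpace X] [MeasurableSpace X] (μ ν : Measure X) (E : Set X)
    (s : ℝ) (u : X → EReal) (x : X) (r : ℝ) : ℝ≥0∞ :=
  (∫⁻ y in ball x r ∩ E, (u y - (ballAvg μ u x r : EReal)).abs ^ s ∂ν) ^ (1 / s)

/-- `(∫_{B(x,r)} g^p dμ)^{1/p}`. -/
def gradNorm {X : Type*} [MetricSpace X] [MeasurableSpace X] (μ : Measure X) (p : ℝ)
    (g : X → ℝ≥0∞) (x : X) (r : ℝ) : ℝ≥0∞ :=
  (∫⁻ y in ball x r, g y ^ p ∂μ) ^ (1 / p)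

/-- `E` is uniformly perfect with constant `a`, at all locations and scales. -/
def UniformlyPerfect {X : Type*} [MetricSpace X] (E : Set X) (a : ℝ) : Prop :=
  ∀ x ∈ E, ∀ r : ℝ, 0 < r → ((E ∩ ball x r) \ ball x (a * r)).Nonempty

end TwoWeight

end

/-! ### Geometric sums and the terms of a chain -/

namespace TwoWeight

/-! Fix B = B(x₀, r), write κ for the measure g^p dμ and k = κ(2λB). For ν-almost every x in B ∩ E,
u(x) is the limit of its averages over B_i = B(x, r/2^i), so |u(x) - u_B| is bounded by a
telescoping sum of mean oscillations. The Poincaré inequality and the definition of Θ bound the i-th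
oscillation by K ν(B_i)^(-1/q) κ(λB_i)^(1/p), where K is a multiple of Θ
(`PoincareAt.osc_le_theta`).

The sum is estimated as in Hedberg's argument. With M(x) = sup_i κ(λB_i)/ν(B_i) (`chainMax`),
κ(λB_i) is at most M ν(B_i) and also at most k. The first bound is good on small balls, the second
on large ones, and since ν(B_i) decays geometrically the smaller of the two sums to a constant times
k^(1/p-1/q) M^(1/q) (`tsum_chain_le`). A Vitali covering gives M a weak (1,1) bound
(`meas_chainMax_gt_le`), hence u - u_B a weak L^q bound (`meas_abs_sub_gt_le`). Integrating over
levels yields every exponent q' < q, with a factor of order 1/(q - q').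

At the exponent q itself, Maz'ya's truncation method upgrades weak to strong: the weak bound is
applied to the truncations of u between t and 2t away from u_B, for dyadic t (`meas_level_le`).
Their gradients live on disjoint level sets, and q/p ≥ 1 lets the powers κ_j^(q/p) be summed.

In part 2 the decay of ν is not assumed. Uniform perfectness puts inside each ball a second,
disjoint ball of comparable measure, so concentric shrinking loses a fixed proportion of ν at every
scale (`reverse_doubling_of_uniformlyPerfect`). -/

/-- A sum of reflected terms over a finite set bounded by `J` is at most the whole series. -/
lemma sum_reflect_le_tsum (A : Finset ℕ) (J : ℕ) (hA : ∀ i ∈ A, i ≤ J) (f : ℕ → ℝ≥0∞) :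
    ∑ i ∈ A, f (J - i) ≤ ∑' k, f k := by
  calc ∑ i ∈ A, f (J - i) = ∑ k ∈ A.image (fun i => J - i), f k := by
        rw [Finset.sum_image]
        intro i hi j hj hij
        have := hA i hi
        have := hA j hj
        simp only at hij
        omega
    _ ≤ ∑' k, f k := ENNReal.sum_le_tsum _

lemma sum_shift_le_tsum (A : Finset ℕ) (J : ℕ) (hA : ∀ i ∈ A, J ≤ i) (f : ℕ → ℝ≥0∞) :
    ∑ i ∈ A, f (i - J) ≤ ∑' k, f k := by
  calc ∑ i ∈ A, f (i - J) = ∑ k ∈ A.image (fun i => i - J), f k := by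
        rw [Finset.sum_image]
        intro i hi j hj hij
        have := hA i hi
        have := hA j hj
        simp only at hij
        omega
    _ ≤ ∑' k, f k := ENNReal.sum_le_tsum _

/-- Bound for `∑ min (s i ^ a) (s i ^ (-b))` when `s` decays geometrically. -/
noncomputable def geomConst (D θ : ℝ≥0∞) (a b : ℝ) : ℝ≥0∞ :=
  D ^ b * (1 - θ ^ b)⁻¹ + D ^ a * (1 - θ ^ a)⁻¹

lemma geomConst_ne_top {D θ : ℝ≥0∞} {a b : ℝ} (hD : D ≠ ∞) (hθ : θ < 1) (ha : 0 < a)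
    (hb : 0 < b) : geomConst D θ a b ≠ ∞ := by
  have key : ∀ c : ℝ, 0 < c → D ^ c * (1 - θ ^ c)⁻¹ ≠ ∞ := fun c hc =>
    ENNReal.mul_ne_top (ENNReal.rpow_ne_top_of_nonneg hc.le hD)
      (ENNReal.inv_ne_top.2 (tsub_pos_of_lt (ENNReal.rpow_lt_one hθ hc)).ne')
  exact ENNReal.add_ne_top.2 ⟨key b hb, key a ha⟩

lemma tsum_mul_pow_rpow (D θ : ℝ≥0∞) {c : ℝ} (hc : 0 < c) :
    ∑' k : ℕ, (D * θ ^ k) ^ c = D ^ c * (1 - θ ^ c)⁻¹ := by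
  rw [← ENNReal.tsum_geometric, ← ENNReal.tsum_mul_left]
  congr 1
  ext k
  rw [ENNReal.mul_rpow_of_nonneg _ _ hc.le, ← ENNReal.rpow_natCast, ← ENNReal.rpow_natCast,
    ← ENNReal.rpow_mul, ← ENNReal.rpow_mul, mul_comm (k : ℝ)]

/-- Terms with s i ≥ 1 are controlled by s^(-b), which grows geometrically towards the last such
index J; terms with s i < 1 by s^a, which decays geometrically from the first such index. The bound
does not see where the crossover occurs. Working with partial sums guarantees that the extreme
indices exist. -/
lemma tsum_min_rpow_le {s : ℕ → ℝ≥0∞} {D θ : ℝ≥0∞} {a b : ℝ}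
    (hs : ∀ i j, s (i + j) ≤ D * θ ^ j * s i) (ha : 0 < a) (hb : 0 < b) :
    ∑' i, min (s i ^ a) (s i ^ (-b)) ≤ geomConst D θ a b := by
  refine ENNReal.tsum_le_of_sum_range_le fun n => ?_
  rw [← Finset.sum_filter_add_sum_filter_not (Finset.range n) (fun i => 1 ≤ s i), geomConst]
  refine add_le_add ?_ ?_
  · rw [← tsum_mul_pow_rpow D θ hb]
    rcases (Finset.filter (fun i => 1 ≤ s i) (Finset.range n)).eq_empty_or_nonempty with h | h
    · rw [h]; simp
    · set A := Finset.filter (fun i => 1 ≤ s i) (Finset.range n) with hA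
      have hJ := A.max'_mem h
      set J := A.max' h
      have hle : ∀ i ∈ A, i ≤ J := fun i hi => A.le_max' i hi
      refine le_trans (Finset.sum_le_sum fun i hi => ?_)
        (sum_reflect_le_tsum A J hle fun k => (D * θ ^ k) ^ b)
      have h1 : 1 ≤ s J := (Finset.mem_filter.1 hJ).2
      have h2 := hs i (J - i)
      rw [Nat.add_sub_cancel' (hle i hi)] at h2
      refine (min_le_right _ _).trans ?_
      rw [ENNReal.rpow_neg, ← ENNReal.inv_rpow]
      refine ENNReal.rpow_le_rpow ?_ hb.le
      rw [ENNReal.inv_le_iff_le_mul]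
      · rw [mul_comm]
        exact h1.trans h2
      · rintro h0 h3
        simp [h3] at h2
        exact absurd h1 (by simp [h2])
      · intro h0 h3
        rw [h3, zero_mul, nonpos_iff_eq_zero] at h2
        exact absurd h1 (by simp [h2])
  · rw [← tsum_mul_pow_rpow D θ ha]
    rcases (Finset.filter (fun i => ¬ 1 ≤ s i) (Finset.range n)).eq_empty_or_nonempty with h | h
    · rw [h]; simp
    · set A := Finset.filter (fun i => ¬ 1 ≤ s i) (Finset.range n) with hA
      have hJ := A.min'_mem h
      set J := A.min' h
      have hle : ∀ i ∈ A, J ≤ i := fun i hi => A.min'_le i hi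
      refine le_trans (Finset.sum_le_sum fun i hi => ?_)
        (sum_shift_le_tsum A J hle fun k => (D * θ ^ k) ^ a)
      have h1 : s J ≤ 1 := (not_le.1 (Finset.mem_filter.1 hJ).2).le
      have h2 := hs J (i - J)
      rw [Nat.add_sub_cancel' (hle i hi)] at h2
      refine (min_le_left _ _).trans (ENNReal.rpow_le_rpow (h2.trans ?_) ha.le)
      simpa using mul_le_mul_right h1 (D * θ ^ (i - J))

/-- The two competing bounds for one term of a chain. -/
lemma chain_term_le {n M k I : ℝ≥0∞} {p q : ℝ} (hp : 0 < p)
    (hn : n ≠ 0) (hn' : n ≠ ∞) (hM : M ≠ 0) (hM' : M ≠ ∞) (hk : k ≠ 0) (hk' : k ≠ ∞)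
    (h1 : I ≤ M * n) (h2 : I ≤ k) :
    n ^ (-(1 / q)) * I ^ (1 / p) ≤
      k ^ (1 / p - 1 / q) * M ^ (1 / q) *
        min ((n * M / k) ^ (1 / p - 1 / q)) ((n * M / k) ^ (-(1 / q))) := by
  have hp' : (0 : ℝ) ≤ 1 / p := by positivity
  have hd : n * M / k = n * M * k⁻¹ := rfl
  have hinv : k⁻¹ ≠ ∞ := ENNReal.inv_ne_top.2 hk
  rw [mul_min]
  refine le_min ?_ ?_
  · calc n ^ (-(1 / q)) * I ^ (1 / p) ≤ n ^ (-(1 / q)) * (M * n) ^ (1 / p) := by gcongr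
      _ = k ^ (1 / p - 1 / q) * M ^ (1 / q) * (n * M / k) ^ (1 / p - 1 / q) := by
        rw [hd, ENNReal.mul_rpow_of_ne_top (ENNReal.mul_ne_top hn' hM') hinv,
          ENNReal.mul_rpow_of_ne_top hn' hM', ENNReal.mul_rpow_of_ne_top hM' hn',
          ENNReal.inv_rpow]
        have e1 : M ^ (1 / p) = M ^ (1 / q) * M ^ (1 / p - 1 / q) := by
          rw [← ENNReal.rpow_add _ _ hM hM']; congr 1; ring
        have e2 : n ^ (1 / p - 1 / q) = n ^ (-(1 / q)) * n ^ (1 / p) := by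
          rw [← ENNReal.rpow_add _ _ hn hn']; congr 1; ring
        have e3 : k ^ (1 / p - 1 / q) * (k ^ (1 / p - 1 / q))⁻¹ = 1 :=
          ENNReal.mul_inv_cancel (by simp [hk, hk']) (by
            exact ENNReal.rpow_ne_top_of_ne_zero hk hk')
        rw [e1, e2]
        calc _ = 1 * (n ^ (-(1 / q)) * n ^ (1 / p) * M ^ (1 / q) * M ^ (1 / p - 1 / q)) := by ring
          _ = _ := by rw [← e3]; ring
  · calc n ^ (-(1 / q)) * I ^ (1 / p) ≤ n ^ (-(1 / q)) * k ^ (1 / p) := by gcongr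
      _ = k ^ (1 / p - 1 / q) * M ^ (1 / q) * (n * M / k) ^ (-(1 / q)) := by
        rw [hd, ENNReal.mul_rpow_of_ne_top (ENNReal.mul_ne_top hn' hM') hinv,
          ENNReal.mul_rpow_of_ne_top hn' hM', ENNReal.inv_rpow]
        have e1 : M ^ (1 / q) * M ^ (-(1 / q)) = 1 := by
          rw [← ENNReal.rpow_add _ _ hM hM']; simp
        have e2 : k ^ (1 / p) = k ^ (1 / p - 1 / q) * (k ^ (-(1 / q)))⁻¹ := by
          rw [← ENNReal.rpow_neg, ← ENNReal.rpow_add _ _ hk hk']; congr 1; ring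
        rw [e2]
        calc _ = 1 * (n ^ (-(1 / q)) * k ^ (1 / p - 1 / q) * (k ^ (-(1 / q)))⁻¹) := by ring
          _ = _ := by rw [← e1]; ring

/-- Each term satisfies a^s = a · a^(s-1) ≤ a · (∑ a)^(s-1). Used with s = q/p to sum over
truncation levels. -/
lemma tsum_rpow_le_rpow_tsum {ι : Type*} (a : ι → ℝ≥0∞) {s : ℝ} (hs : 1 ≤ s) :
    ∑' i, a i ^ s ≤ (∑' i, a i) ^ s := by
  have hsplit : ∀ x : ℝ≥0∞, x ^ s = x * x ^ (s - 1) := fun x => by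
    conv_lhs => rw [show s = 1 + (s - 1) by ring]
    rw [ENNReal.rpow_add_of_nonneg _ _ zero_le_one (by linarith), ENNReal.rpow_one]
  calc ∑' i, a i ^ s ≤ ∑' i, a i * (∑' i, a i) ^ (s - 1) := by
        refine ENNReal.tsum_le_tsum fun i => ?_
        rw [hsplit]
        gcongr
        exact ENNReal.le_tsum i
    _ = (∑' i, a i) ^ s := by rw [ENNReal.tsum_mul_right, ← hsplit]

end TwoWeight

/-! ### Local doubling and the weak (1,1) bound for the chain maximal function -/

namespace TwoWeight

/-- The doubling and decay properties of `μ` and `ν` near the ball `B(x₀, r)`, in the form in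
which they are used in chaining and covering arguments. -/
structure LocalDoubling {X : Type*} [MetricSpace X] [MeasurableSpace X] (μ ν : Measure X)
    (E : Set X) (x₀ : X) (r lam : ℝ) (D θ : ℝ≥0∞) : Prop where
  r_pos : 0 < r
  one_le_lam : 1 ≤ lam
  D_ne_top : D ≠ ∞
  one_le_D : 1 ≤ D
  θ_lt_one : θ < 1
  center_mem : x₀ ∈ E
  pos : ∀ x ∈ ball x₀ r ∩ E, ∀ ρ : ℝ, 0 < ρ → 0 < μ (ball x ρ) ∧ 0 < ν (ball x ρ)
  lt_top : ∀ x ∈ ball x₀ r ∩ E, ∀ ρ : ℝ, 0 < ρ → ρ ≤ 2 * lam * r →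
    μ (ball x ρ) < ∞ ∧ ν (ball x ρ) < ∞
  half : ∀ x ∈ ball x₀ r ∩ E, ∀ ρ : ℝ, 0 < ρ → ρ ≤ r →
    μ (ball x ρ) ≤ D * μ (ball x (ρ / 2))
  base : ∀ x ∈ ball x₀ r ∩ E, μ (ball x₀ (2 * r)) ≤ D * μ (ball x r)
  enlarge : ∀ x ∈ ball x₀ r ∩ E, ∀ ρ : ℝ, 0 < ρ → ρ ≤ r →
    ν (ball x (3 * lam * ρ)) ≤ D * ν (ball x ρ)
  decay : ∀ x ∈ ball x₀ r ∩ E, ∀ i j : ℕ,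
    ν (ball x (r / 2 ^ (i + j))) ≤ D * θ ^ j * ν (ball x (r / 2 ^ i))

/-- Maximal function of `κ` relative to `ν` along the dyadic chain of balls at a point. -/
noncomputable def chainMax {X : Type*} [MetricSpace X] [MeasurableSpace X] (ν κ : Measure X)
    (lam r : ℝ) (x : X) : ℝ≥0∞ :=
  ⨆ i : ℕ, κ (ball x (lam * (r / 2 ^ i))) / ν (ball x (r / 2 ^ i))

section

variable {X : Type*} [MetricSpace X] [MeasurableSpace X] {μ ν κ : Measure X}
  {E : Set X} {x₀ : X} {r lam : ℝ} {D θ : ℝ≥0∞}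

lemma div_two_pow_le {r : ℝ} (hr : 0 < r) (i : ℕ) : r / 2 ^ i ≤ r :=
  div_le_self hr.le (one_le_pow₀ one_le_two)

lemma LocalDoubling.center (h : LocalDoubling μ ν E x₀ r lam D θ) : x₀ ∈ ball x₀ r ∩ E :=
  ⟨mem_ball_self h.r_pos, h.center_mem⟩

lemma LocalDoubling.radius_le (h : LocalDoubling μ ν E x₀ r lam D θ) {ρ : ℝ} (hρ : ρ ≤ r) :
    ρ ≤ 2 * lam * r := by
  have := h.r_pos
  have := h.one_le_lam
  nlinarith

lemma LocalDoubling.ball_subset (h : LocalDoubling μ ν E x₀ r lam D θ) {x : X}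
    (hx : x ∈ ball x₀ r ∩ E) {ρ : ℝ} (hρ : ρ ≤ r) :
    ball x (lam * ρ) ⊆ ball x₀ (2 * lam * r) := by
  refine ball_subset_ball' ?_
  have h1 := mem_ball.1 hx.1
  have := h.r_pos
  have := h.one_le_lam
  nlinarith

/-- Vitali's covering argument is run on the dilated balls λB, so that their κ-masses add up inside
2λB₀, where B₀ = B(x₀, r); the return to ν of the undilated balls is the `enlarge` property.
Measurability of the superlevel set is not needed. -/
lemma meas_chainMax_gt_le [OpensMeasurableSpace X] (h : LocalDoubling μ ν E x₀ r lam D θ)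
    {s : ℝ≥0∞} (hs : s ≠ 0) (hs' : s ≠ ∞) :
    ν {x | x ∈ ball x₀ r ∩ E ∧ s < chainMax ν κ lam r x} ≤
      D * κ (ball x₀ (2 * lam * r)) / s := by
  set A := {x | x ∈ ball x₀ r ∩ E ∧ s < chainMax ν κ lam r x} with hA
  have hr := h.r_pos
  have hlam := h.one_le_lam
  have hch : ∀ x : X, ∃ i : ℕ, x ∈ A →
      s < κ (ball x (lam * (r / 2 ^ i))) / ν (ball x (r / 2 ^ i)) := by
    intro x
    by_cases hx : x ∈ A
    · obtain ⟨i, hi⟩ := lt_iSup_iff.1 hx.2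
      exact ⟨i, fun _ => hi⟩
    · exact ⟨0, fun h => absurd h hx⟩
  choose i hi using hch
  have hρ : ∀ x, 0 < r / 2 ^ i x := fun x => by positivity
  have hρ' : ∀ x, r / 2 ^ i x ≤ r := fun x => div_two_pow_le hr _
  have hlρ : ∀ x, 0 < lam * (r / 2 ^ i x) := fun x => mul_pos (by linarith) (hρ x)
  obtain ⟨u, huA, hdisj, hcov⟩ := Vitali.exists_disjoint_subfamily_covering_enlargement
    (fun x => ball x (lam * (r / 2 ^ i x))) A (fun x => lam * (r / 2 ^ i x)) 2 one_lt_two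
    (fun x _ => (hlρ x).le) (lam * r)
    (fun x _ => mul_le_mul_of_nonneg_left (hρ' x) (by linarith))
    (fun x _ => ⟨x, mem_ball_self (hlρ x)⟩)
  have hsub : ∀ x ∈ u, ball x (lam * (r / 2 ^ i x)) ⊆ ball x₀ (2 * lam * r) :=
    fun x hx => h.ball_subset (huA hx).1 (hρ' x)
  -- Disjoint balls of positive ν-measure inside a ball of finite ν-measure are countably many; no
  -- separability of the space is involved.
  have hcount : u.Countable := by
    have hfin : IsFiniteMeasure (ν.restrict (ball x₀ (2 * lam * r))) := by
      refine ⟨?_⟩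
      rw [Measure.restrict_apply_univ]
      exact (h.lt_top x₀ h.center _ (by positivity) le_rfl).2
    have := Measure.countable_meas_pos_of_disjoint_iUnion
      (μ := ν.restrict (ball x₀ (2 * lam * r)))
      (As := fun x : u => ball (x : X) (lam * (r / 2 ^ i x))) (fun _ => measurableSet_ball)
      (fun a b hab => hdisj a.2 b.2 (fun hh => hab (Subtype.ext hh)))
    rw [show {x : u | 0 < (ν.restrict (ball x₀ (2 * lam * r)))
      (ball (x : X) (lam * (r / 2 ^ i x)))} = univ from ?_] at this
    · exact countable_univ_iff.1 this
    · refine eq_univ_of_forall fun x => ?_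
      rw [mem_ofPred_eq, Measure.restrict_apply measurableSet_ball,
        inter_eq_self_of_subset_left (hsub x x.2)]
      exact (h.pos x (huA x.2).1 _ (hlρ x)).2
  -- Only the centres have to be covered: if the dilated balls at a and b meet and the radius at a
  -- is at most twice that at b, then a lies within three radii of b. Hence 3λ rather than Vitali's
  -- usual 5λ.
  have hsubset : A ⊆ ⋃ b ∈ u, ball b (3 * lam * (r / 2 ^ i b)) := by
    intro a ha
    obtain ⟨b, hb, ⟨z, hza, hzb⟩, hab⟩ := hcov a ha
    refine mem_biUnion hb ?_
    rw [mem_ball] at hza hzb ⊢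
    have := dist_triangle a z b
    rw [dist_comm a z] at this
    linarith
  have := hcount.to_subtype
  calc ν A ≤ ∑' b : u, ν (ball (b : X) (3 * lam * (r / 2 ^ i b))) :=
        (measure_mono hsubset).trans (measure_biUnion_le ν hcount _)
    _ ≤ ∑' b : u, D / s * κ (ball (b : X) (lam * (r / 2 ^ i b))) := by
        refine ENNReal.tsum_le_tsum fun b => ?_
        have hb := huA b.2
        have h1 := h.enlarge b hb.1 _ (hρ b) (hρ' b)
        have h2 := (hi b hb).le
        rw [ENNReal.le_div_iff_mul_le
          (Or.inl (h.pos b hb.1 _ (hρ b)).2.ne')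
          (Or.inl (h.lt_top b hb.1 _ (hρ b) (h.radius_le (hρ' b))).2.ne)] at h2
        refine h1.trans ?_
        rw [ENNReal.div_eq_inv_mul, mul_comm _ D, mul_assoc]
        gcongr
        rw [← ENNReal.div_eq_inv_mul, ENNReal.le_div_iff_mul_le (Or.inl hs) (Or.inl hs'), mul_comm]
        exact h2
    _ = D / s * ∑' b : u, κ (ball (b : X) (lam * (r / 2 ^ i b))) := ENNReal.tsum_mul_left
    _ ≤ D / s * κ (ball x₀ (2 * lam * r)) := by
        gcongr
        rw [← measure_iUnion (μ := κ) (f := fun b : u => ball (b : X) (lam * (r / 2 ^ i b)))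
          (fun a b hab => hdisj a.2 b.2 (fun hh => hab (Subtype.ext hh)))
          (fun _ => measurableSet_ball)]
        exact measure_mono (iUnion_subset fun b => hsub b b.2)
    _ = D * κ (ball x₀ (2 * lam * r)) / s := by
        simp only [div_eq_mul_inv]; ring

lemma ae_chainMax_lt_top [OpensMeasurableSpace X] (h : LocalDoubling μ ν E x₀ r lam D θ)
    (hκ : κ (ball x₀ (2 * lam * r)) ≠ ∞) :
    ∀ᵐ x ∂ν, x ∈ ball x₀ r ∩ E → chainMax ν κ lam r x < ∞ := by
  rw [ae_iff]
  -- The weak bound is used at the levels n + 1, since it requires a nonzero level, and n tends to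
  -- infinity.
  refine le_antisymm (ge_of_tendsto' (x := atTop)
    (f := fun n : ℕ => D * κ (ball x₀ (2 * lam * r)) / ((n + 1 : ℕ) : ℝ≥0∞)) ?_ fun n => ?_) zero_le
  · have := ENNReal.Tendsto.const_div (a := D * κ (ball x₀ (2 * lam * r)))
      (ENNReal.tendsto_nat_nhds_top.comp (tendsto_add_atTop_nat 1))
      (Or.inr (ENNReal.mul_ne_top h.D_ne_top hκ))
    simpa using this
  · refine le_trans (measure_mono ?_) (meas_chainMax_gt_le h (by simp) (ENNReal.natCast_ne_top _))
    intro x hx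
    simp only [mem_ofPred_eq, Classical.not_imp, not_lt, top_le_iff] at hx ⊢
    exact ⟨hx.1, hx.2 ▸ ENNReal.natCast_lt_top _⟩

end

end TwoWeight

/-! ### Telescoping along chains and the pointwise estimate -/

namespace TwoWeight

section

variable {X : Type*} [MeasurableSpace X] {μ : Measure X} {D : ℝ≥0∞}

lemma enorm_setAverage_sub_le {f : X → ℝ} {A : Set X} (b : ℝ) (hf : IntegrableOn f A μ)
    (h0 : μ A ≠ 0) (hA : μ A ≠ ∞) :
    ‖(⨍ y in A, f y ∂μ) - b‖ₑ ≤ ⨍⁻ y in A, ‖f y - b‖ₑ ∂μ := by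
  have hfin : IsFiniteMeasure (μ.restrict A) := ⟨by simpa using hA.lt_top⟩
  have hr : μ.real A ≠ 0 := by
    simp [Measure.real, ENNReal.toReal_eq_zero_iff, h0, hA]
  have h1 : (⨍ y in A, f y ∂μ) - b = (μ.real A)⁻¹ • ∫ y in A, (f y - b) ∂μ := by
    rw [integral_sub hf (integrable_const b), setAverage_eq, smul_sub]
    simp [hr]
  have h2 : ‖(μ.real A)⁻¹‖ₑ = (μ A)⁻¹ := by
    rw [enorm_inv hr, Real.enorm_eq_ofReal measureReal_nonneg, ofReal_measureReal hA]
  rw [h1, enorm_smul, h2, setLAverage_eq, ENNReal.div_eq_inv_mul]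
  gcongr
  exact enorm_integral_le_lintegral_enorm _

lemma setLAverage_le_of_subset {F : X → ℝ≥0∞} {A A' : Set X} (hAA : A ⊆ A')
    (h0 : μ A ≠ 0) (hA : μ A' ≠ ∞) (hD : μ A' ≤ D * μ A) :
    ⨍⁻ y in A, F y ∂μ ≤ D * ⨍⁻ y in A', F y ∂μ := by
  have h0' : μ A' ≠ 0 := fun h => h0 (measure_mono_null hAA h)
  have hAfin : μ A ≠ ∞ := ne_top_of_le_ne_top hA (measure_mono hAA)
  rw [setLAverage_eq, setLAverage_eq, ENNReal.div_eq_inv_mul, ENNReal.div_eq_inv_mul, ← mul_assoc]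
  refine mul_le_mul' ?_ (lintegral_mono_set hAA)
  rw [← div_eq_mul_inv, ENNReal.le_div_iff_mul_le (Or.inl h0') (Or.inl hA)]
  calc (μ A)⁻¹ * μ A' ≤ (μ A)⁻¹ * (D * μ A) := by gcongr
    _ = D * ((μ A)⁻¹ * μ A) := by ring
    _ = D := by rw [ENNReal.inv_mul_cancel h0 hAfin, mul_one]

lemma enorm_setAverage_sub_setAverage_le {f : X → ℝ} {A A' : Set X} (hAA : A ⊆ A')
    (hf : IntegrableOn f A' μ) (h0 : μ A ≠ 0) (hA : μ A' ≠ ∞) (hD : μ A' ≤ D * μ A) (b : ℝ) :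
    ‖(⨍ y in A, f y ∂μ) - b‖ₑ ≤ D * ⨍⁻ y in A', ‖f y - b‖ₑ ∂μ :=
  (enorm_setAverage_sub_le b (hf.mono_set hAA) h0
    (ne_top_of_le_ne_top hA (measure_mono hAA))).trans (setLAverage_le_of_subset hAA h0 hA hD)

end

/-- The limit may a priori be infinite; a finite S traps the sequence in a compact real interval and
excludes this. -/
lemma abs_sub_le_of_tendsto {a : ℕ → ℝ} {L : EReal} {c : ℝ} {S : ℝ≥0∞}
    (ha : Tendsto (fun n => (a n : EReal)) atTop (𝓝 L)) (hS : ∀ n, ‖a n - c‖ₑ ≤ S) :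
    (L - (c : EReal)).abs ≤ S := by
  rcases eq_or_ne S ∞ with rfl | hS'
  · exact le_top
  lift S to NNReal using hS'
  have hab : ∀ n, |a n - c| ≤ S := fun n => by
    have := hS n
    rw [Real.enorm_eq_ofReal_abs, ENNReal.ofReal_le_iff_le_toReal ENNReal.coe_ne_top] at this
    simpa using this
  have h1 : L ≤ ((c + S : ℝ) : EReal) :=
    le_of_tendsto' ha fun n => EReal.coe_le_coe_iff.2 (by linarith [(abs_le.1 (hab n)).2])
  have h2 : ((c - S : ℝ) : EReal) ≤ L :=
    ge_of_tendsto' ha fun n => EReal.coe_le_coe_iff.2 (by linarith [(abs_le.1 (hab n)).1])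
  induction L with
  | bot => exact absurd h2 (not_le.2 (EReal.bot_lt_coe _))
  | top => exact absurd h1 (not_le.2 (EReal.coe_lt_top _))
  | coe x =>
    rw [EReal.coe_le_coe_iff] at h1 h2
    rw [← EReal.coe_sub, EReal.abs_def, ENNReal.ofReal_le_iff_le_toReal ENNReal.coe_ne_top]
    exact abs_le.2 ⟨by simp; linarith, by simp; linarith⟩

section

variable {X : Type*} [MetricSpace X] [MeasurableSpace X] {μ ν κ : Measure X}
  {E : Set X} {x₀ : X} {r lam : ℝ} {D θ : ℝ≥0∞}

/-- Mean oscillation bounds near `B(x₀, r)` in terms of the gradient measure `κ` and of `ν`. -/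
structure OscBound (μ ν κ : Measure X) (E : Set X) (x₀ : X) (r lam p q : ℝ) (K : ℝ≥0∞)
    (f : X → ℝ) : Prop where
  integrable : ∀ x ∈ ball x₀ r ∩ E, ∀ ρ : ℝ, 0 < ρ → ρ ≤ r → IntegrableOn f (ball x ρ) μ
  integrable_large : IntegrableOn f (ball x₀ (2 * r)) μ
  small : ∀ x ∈ ball x₀ r ∩ E, ∀ ρ : ℝ, 0 < ρ → ρ ≤ r →
    ⨍⁻ y in ball x ρ, ‖f y - ⨍ z in ball x ρ, f z ∂μ‖ₑ ∂μ ≤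
      K * (ν (ball x ρ) ^ (-(1 / q)) * κ (ball x (lam * ρ)) ^ (1 / p))
  large : ⨍⁻ y in ball x₀ (2 * r), ‖f y - ⨍ z in ball x₀ (2 * r), f z ∂μ‖ₑ ∂μ ≤
      K * (ν (ball x₀ r) ^ (-(1 / q)) * κ (ball x₀ (2 * lam * r)) ^ (1 / p))

variable {p q : ℝ} {K : ℝ≥0∞} {f : X → ℝ}

/-- By `chain_term_le` the terms are governed by s_i = ν(B_i) M / k, which inherits the geometric
decay of ν, so `tsum_min_rpow_le` applies whatever the size of M / k. -/
lemma tsum_chain_le (h : LocalDoubling μ ν E x₀ r lam D θ) (hp : 0 < p) (hpq : p < q)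
    (hκ : κ (ball x₀ (2 * lam * r)) ≠ ∞) {x : X} (hx : x ∈ ball x₀ r ∩ E)
    (hM : chainMax ν κ lam r x < ∞) :
    ∑' i : ℕ, ν (ball x (r / 2 ^ i)) ^ (-(1 / q)) * κ (ball x (lam * (r / 2 ^ i))) ^ (1 / p) ≤
      geomConst D θ (1 / p - 1 / q) (1 / q) *
        (κ (ball x₀ (2 * lam * r)) ^ (1 / p - 1 / q) * chainMax ν κ lam r x ^ (1 / q)) := by
  set k := κ (ball x₀ (2 * lam * r)) with hk
  set M := chainMax ν κ lam r x with hMdef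
  have hr := h.r_pos
  have hq : 0 < q := hp.trans hpq
  have hρ : ∀ i : ℕ, 0 < r / 2 ^ i := fun i => by positivity
  have hn0 : ∀ i : ℕ, ν (ball x (r / 2 ^ i)) ≠ 0 := fun i => (h.pos x hx _ (hρ i)).2.ne'
  have hn : ∀ i : ℕ, ν (ball x (r / 2 ^ i)) ≠ ∞ := fun i =>
    (h.lt_top x hx _ (hρ i) (h.radius_le (div_two_pow_le hr i))).2.ne
  have hI : ∀ i : ℕ, κ (ball x (lam * (r / 2 ^ i))) ≤ M * ν (ball x (r / 2 ^ i)) := fun i => by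
    rw [← ENNReal.div_le_iff_le_mul (Or.inl (hn0 i)) (Or.inl (hn i))]
    exact le_iSup (fun i : ℕ => κ (ball x (lam * (r / 2 ^ i))) / ν (ball x (r / 2 ^ i))) i
  have hI' : ∀ i : ℕ, κ (ball x (lam * (r / 2 ^ i))) ≤ k := fun i =>
    measure_mono (h.ball_subset hx (div_two_pow_le hr i))
  -- The ratio s_i is useless if M or k is zero, but then κ(λB_i) = 0 for every i and the series
  -- vanishes.
  by_cases h0 : M = 0 ∨ k = 0
  · have hz : ∀ i : ℕ, κ (ball x (lam * (r / 2 ^ i))) = 0 := fun i => by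
      rcases h0 with h0 | h0
      · simpa [h0] using hI i
      · simpa [h0] using hI' i
    have hp' : 0 < 1 / p := by positivity
    simp_rw [hz, ENNReal.zero_rpow_of_pos hp']
    simp
  · push Not at h0
    calc _ ≤ ∑' i : ℕ, k ^ (1 / p - 1 / q) * M ^ (1 / q) *
          min ((ν (ball x (r / 2 ^ i)) * M / k) ^ (1 / p - 1 / q))
            ((ν (ball x (r / 2 ^ i)) * M / k) ^ (-(1 / q))) :=
          ENNReal.tsum_le_tsum fun i =>
            chain_term_le hp (hn0 i) (hn i) h0.1 hM.ne h0.2 hκ (hI i) (hI' i)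
      _ ≤ k ^ (1 / p - 1 / q) * M ^ (1 / q) * geomConst D θ (1 / p - 1 / q) (1 / q) := by
          rw [ENNReal.tsum_mul_left]
          gcongr
          refine tsum_min_rpow_le (fun i j => ?_)
            (sub_pos.2 (one_div_lt_one_div_of_lt hp hpq)) (by positivity)
          calc ν (ball x (r / 2 ^ (i + j))) * M / k
              ≤ D * θ ^ j * ν (ball x (r / 2 ^ i)) * M / k := by
                gcongr; exact h.decay x hx i j
            _ = _ := by simp only [div_eq_mul_inv]; ring
      _ = _ := by rw [mul_comm]

/-- The constant in the pointwise chaining estimate. -/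
noncomputable def chainConst (D θ : ℝ≥0∞) (p q : ℝ) : ℝ≥0∞ :=
  2 * D + D * geomConst D θ (1 / p - 1 / q) (1 / q)

lemma chainConst_ne_top (hD : D ≠ ∞) (hθ : θ < 1) (hp : 0 < p) (hpq : p < q) :
    chainConst D θ p q ≠ ∞ := by
  have hq : 0 < q := hp.trans hpq
  exact ENNReal.add_ne_top.2 ⟨ENNReal.mul_ne_top (by simp) hD,
    ENNReal.mul_ne_top hD (geomConst_ne_top hD hθ
      (sub_pos.2 (one_div_lt_one_div_of_lt hp hpq)) (by positivity))⟩

/-- Passing to a concentric ball of half the radius costs one mean oscillation times the doubling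
constant. The chain at x starts at B(x, r), which is not B(x₀, r): both averages are compared with
the one over B(x₀, 2r), whence the leading 2D. -/
lemma enorm_chain_le (h : LocalDoubling μ ν E x₀ r lam D θ) (hf : OscBound μ ν κ E x₀ r lam p q K f)
    {x : X} (hx : x ∈ ball x₀ r ∩ E) (n : ℕ) :
    ‖(⨍ z in ball x (r / 2 ^ n), f z ∂μ) - ⨍ z in ball x₀ r, f z ∂μ‖ₑ ≤
      2 * D * (K * (ν (ball x₀ r) ^ (-(1 / q)) * κ (ball x₀ (2 * lam * r)) ^ (1 / p))) +
      ∑ i ∈ Finset.range n, D * (K * (ν (ball x (r / 2 ^ i)) ^ (-(1 / q)) *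
        κ (ball x (lam * (r / 2 ^ i))) ^ (1 / p))) := by
  have hr := h.r_pos
  have hlam := h.one_le_lam
  have hfin2 : μ (ball x₀ (2 * r)) ≠ ∞ :=
    (h.lt_top x₀ h.center _ (by positivity) (by nlinarith)).1.ne
  induction n with
  | zero =>
    simp only [pow_zero, div_one, Finset.range_zero, Finset.sum_empty, add_zero]
    have hsub : ∀ y ∈ ball x₀ r ∩ E, ball y r ⊆ ball x₀ (2 * r) := fun y hy =>
      ball_subset_ball' (by have := mem_ball.1 hy.1; linarith)
    have key : ∀ y ∈ ball x₀ r ∩ E,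
        ‖(⨍ z in ball y r, f z ∂μ) - ⨍ z in ball x₀ (2 * r), f z ∂μ‖ₑ ≤
        D * (K * (ν (ball x₀ r) ^ (-(1 / q)) * κ (ball x₀ (2 * lam * r)) ^ (1 / p))) :=
      fun y hy => (enorm_setAverage_sub_setAverage_le (hsub y hy) hf.integrable_large
        (h.pos y hy r hr).1.ne' hfin2 (h.base y hy) _).trans (by gcongr; exact hf.large)
    calc _ = ‖((⨍ z in ball x r, f z ∂μ) - ⨍ z in ball x₀ (2 * r), f z ∂μ) -
          ((⨍ z in ball x₀ r, f z ∂μ) - ⨍ z in ball x₀ (2 * r), f z ∂μ)‖ₑ := by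
          congr 1; ring
      _ ≤ _ := enorm_sub_le
      _ ≤ _ := add_le_add (key x hx) (key x₀ h.center)
      _ = _ := by ring
  | succ n ih =>
    have hρ : 0 < r / 2 ^ n := by positivity
    have hρ' := div_two_pow_le hr n
    have hhalf : r / 2 ^ (n + 1) = r / 2 ^ n / 2 := by rw [pow_succ]; field_simp
    have hstep : ‖(⨍ z in ball x (r / 2 ^ (n + 1)), f z ∂μ) - ⨍ z in ball x (r / 2 ^ n), f z ∂μ‖ₑ ≤
        D * (K * (ν (ball x (r / 2 ^ n)) ^ (-(1 / q)) *
          κ (ball x (lam * (r / 2 ^ n))) ^ (1 / p))) := by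
      rw [hhalf]
      exact (enorm_setAverage_sub_setAverage_le (ball_subset_ball (by linarith))
        (hf.integrable x hx _ hρ hρ') (h.pos x hx _ (by linarith)).1.ne'
        (h.lt_top x hx _ hρ (h.radius_le hρ')).1.ne (h.half x hx _ hρ hρ') _).trans
        (by gcongr; exact hf.small x hx _ hρ hρ')
    rw [Finset.sum_range_succ, ← add_assoc]
    refine le_trans ?_ (add_le_add ih hstep)
    rw [← sub_add_sub_cancel' (⨍ z in ball x (r / 2 ^ n), f z ∂μ)]
    exact enorm_add_le _ _

/-- Pointwise estimate: limits of averages along the chain are controlled by `chainMax`. -/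
lemma abs_sub_setAverage_le (h : LocalDoubling μ ν E x₀ r lam D θ) (hp : 0 < p) (hpq : p < q)
    (hf : OscBound μ ν κ E x₀ r lam p q K f)
    (hκ : κ (ball x₀ (2 * lam * r)) ≠ ∞) {x : X} (hx : x ∈ ball x₀ r ∩ E)
    (hM : chainMax ν κ lam r x < ∞) {L : EReal}
    (hL : Tendsto (fun n : ℕ => ((⨍ z in ball x (r / 2 ^ n), f z ∂μ : ℝ) : EReal)) atTop (𝓝 L)) :
    (L - ((⨍ z in ball x₀ r, f z ∂μ : ℝ) : EReal)).abs ≤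
      chainConst D θ p q * K *
        (ν (ball x₀ r) ^ (-(1 / q)) * κ (ball x₀ (2 * lam * r)) ^ (1 / p) +
        κ (ball x₀ (2 * lam * r)) ^ (1 / p - 1 / q) * chainMax ν κ lam r x ^ (1 / q)) := by
  refine abs_sub_le_of_tendsto hL fun n => (enorm_chain_le h hf hx n).trans ?_
  rw [← Finset.mul_sum, ← Finset.mul_sum]
  have h1 := (ENNReal.sum_le_tsum (Finset.range n)).trans (tsum_chain_le h hp hpq hκ hx hM)
  refine (add_le_add_right (mul_le_mul_right (mul_le_mul_right h1 K) D) _).trans ?_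
  rw [chainConst]
  set g := geomConst D θ (1 / p - 1 / q) (1 / q)
  set A := ν (ball x₀ r) ^ (-(1 / q)) * κ (ball x₀ (2 * lam * r)) ^ (1 / p)
  set B := κ (ball x₀ (2 * lam * r)) ^ (1 / p - 1 / q) * chainMax ν κ lam r x ^ (1 / q)
  -- The cross terms are added only to make the bound factor.
  calc 2 * D * (K * A) + D * (K * (g * B)) ≤
        2 * D * (K * A) + D * (K * (g * B)) + (2 * D * K * B + D * g * K * A) := le_self_add
    _ = (2 * D + D * g) * K * (A + B) := by ring

end

end TwoWeight

/-! ### The weak type estimate -/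

namespace TwoWeight

section

variable {X : Type*} [MetricSpace X] [MeasurableSpace X] {μ ν κ : Measure X}
  {E : Set X} {x₀ : X} {r lam : ℝ} {D θ : ℝ≥0∞} {p q : ℝ} {K : ℝ≥0∞} {f : X → ℝ}

/-- The constant in the weak type estimate. -/
noncomputable def weakConst (D θ : ℝ≥0∞) (p q : ℝ) : ℝ≥0∞ :=
  2 * D * (2 * chainConst D θ p q) ^ q

lemma weakConst_ne_top (hD : D ≠ ∞) (hθ : θ < 1) (hp : 0 < p) (hpq : p < q) :
    weakConst D θ p q ≠ ∞ :=
  ENNReal.mul_ne_top (ENNReal.mul_ne_top (by simp) hD)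
    (ENNReal.rpow_ne_top_of_nonneg (hp.trans hpq).le
      (ENNReal.mul_ne_top (by simp) (chainConst_ne_top hD hθ hp hpq)))

/-- Treats the part of the pointwise bound that does not depend on x: if it reaches t, then the
measure n of the whole ball already obeys the weak estimate. -/
lemma meas_le_of_lt_mul_rpow_neg {n t A k : ℝ≥0∞} (hq : 0 < q)
    (hn : n ≠ 0) (hn' : n ≠ ∞) (ht : t ≠ 0) (ht' : t ≠ ∞)
    (h : t ≤ A * (n ^ (-(1 / q)) * k ^ (1 / p))) : n ≤ A ^ q * k ^ (q / p) / t ^ q := by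
  have h1 := ENNReal.rpow_le_rpow h hq.le
  have e : (1 / p) * q = q / p := by ring
  rw [ENNReal.mul_rpow_of_nonneg _ _ hq.le, ENNReal.mul_rpow_of_nonneg _ _ hq.le,
    ← ENNReal.rpow_mul, ← ENNReal.rpow_mul, neg_mul, one_div_mul_cancel hq.ne',
    ENNReal.rpow_neg_one, e] at h1
  rw [ENNReal.le_div_iff_mul_le (Or.inl (by simp [ht, ht']))
    (Or.inl (ENNReal.rpow_ne_top_of_nonneg hq.le ht'))]
  calc n * t ^ q ≤ n * (A ^ q * (n⁻¹ * k ^ (q / p))) := by gcongr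
    _ = n * n⁻¹ * (A ^ q * k ^ (q / p)) := by ring
    _ = _ := by rw [ENNReal.mul_inv_cancel hn hn', one_mul]

/-- Weak type estimate for the oscillation on `B(x₀, r) ∩ E`. -/
lemma meas_abs_sub_gt_le [OpensMeasurableSpace X] (h : LocalDoubling μ ν E x₀ r lam D θ)
    (hp : 0 < p) (hpq : p < q) (hf : OscBound μ ν κ E x₀ r lam p q K f) (hK : K ≠ ∞)
    (hκ : κ (ball x₀ (2 * lam * r)) ≠ ∞) {v : X → EReal}
    (hv : ∀ᵐ x ∂ν, x ∈ ball x₀ r ∩ E → Tendsto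
      (fun n : ℕ => ((⨍ z in ball x (r / 2 ^ n), f z ∂μ : ℝ) : EReal)) atTop (𝓝 (v x)))
    {t : ℝ≥0∞} (ht : t ≠ 0) (ht' : t ≠ ∞) :
    ν {x | x ∈ ball x₀ r ∩ E ∧ t < (v x - ((⨍ z in ball x₀ r, f z ∂μ : ℝ) : EReal)).abs} ≤
      weakConst D θ p q * (K ^ q * κ (ball x₀ (2 * lam * r)) ^ (q / p)) / t ^ q := by
  set k := κ (ball x₀ (2 * lam * r)) with hk
  set C := chainConst D θ p q with hC
  set A := 2 * C * K with hA
  have hq : 0 < q := hp.trans hpq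
  have hCt : C ≠ ∞ := chainConst_ne_top h.D_ne_top h.θ_lt_one hp hpq
  have hAt : A ≠ ∞ := ENNReal.mul_ne_top (ENNReal.mul_ne_top (by simp) hCt) hK
  have hexp : 0 < 1 / p - 1 / q := sub_pos.2 (one_div_lt_one_div_of_lt hp hpq)
  have hn0 := (h.pos x₀ h.center r h.r_pos).2.ne'
  have hn := (h.lt_top x₀ h.center r h.r_pos (h.radius_le le_rfl)).2.ne
  -- If a sum of two terms exceeds t, one of them is at least t/2; the 2 in A absorbs this. The
  -- condition in T₁ is the same for all x, so T₁ is either empty or all of B ∩ E.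
  set T₁ := {x | x ∈ ball x₀ r ∩ E ∧ t ≤ A * (ν (ball x₀ r) ^ (-(1 / q)) * k ^ (1 / p))} with hT₁
  set T₂ := {x | x ∈ ball x₀ r ∩ E ∧
    t < A * (k ^ (1 / p - 1 / q) * chainMax ν κ lam r x ^ (1 / q))} with hT₂
  have hsub : ν {x | x ∈ ball x₀ r ∩ E ∧
      t < (v x - ((⨍ z in ball x₀ r, f z ∂μ : ℝ) : EReal)).abs} ≤ ν (T₁ ∪ T₂) := by
    refine measure_mono_ae ?_
    filter_upwards [hv, ae_chainMax_lt_top h hκ] with x hx1 hx2 hx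
    obtain ⟨hxS, hxt⟩ := hx
    have h3 := hxt.trans_le (abs_sub_setAverage_le h hp hpq hf hκ hxS (hx2 hxS) (hx1 hxS))
    by_contra hcon
    have hcon1 := fun hh => hcon (Or.inl ⟨hxS, hh⟩)
    have hcon2 := fun hh => hcon (Or.inr ⟨hxS, hh⟩)
    rw [imp_false, not_le] at hcon1
    rw [imp_false, not_lt] at hcon2
    have h4 := ENNReal.mul_lt_mul_right (a := 2) (by simp) (by simp) h3
    have h5 := ENNReal.add_lt_add_of_lt_of_le (ne_top_of_le_ne_top ht' hcon2) hcon1 hcon2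
    refine absurd h4 (not_lt.2 ?_)
    calc _ = A * (ν (ball x₀ r) ^ (-(1 / q)) * k ^ (1 / p)) +
          A * (k ^ (1 / p - 1 / q) * chainMax ν κ lam r x ^ (1 / q)) := by rw [hA]; ring
      _ ≤ t + t := h5.le
      _ = 2 * t := (two_mul t).symm
  have hm1 : ν T₁ ≤ A ^ q * k ^ (q / p) / t ^ q := by
    by_cases hc : t ≤ A * (ν (ball x₀ r) ^ (-(1 / q)) * k ^ (1 / p))
    · refine (measure_mono fun x hx => hx.1.1).trans
        (meas_le_of_lt_mul_rpow_neg hq hn0 hn ht ht' hc)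
    · rw [hT₁, show {x | x ∈ ball x₀ r ∩ E ∧
        t ≤ A * (ν (ball x₀ r) ^ (-(1 / q)) * k ^ (1 / p))} = ∅ from
          eq_empty_of_forall_notMem fun x hx => hc hx.2, measure_empty]
      exact zero_le
  have hm2 : ν T₂ ≤ D * (A ^ q * k ^ (q / p) / t ^ q) := by
    by_cases hA0 : A = 0 ∨ k = 0
    · rw [hT₂, show {x | x ∈ ball x₀ r ∩ E ∧
        t < A * (k ^ (1 / p - 1 / q) * chainMax ν κ lam r x ^ (1 / q))} = ∅ from
          eq_empty_of_forall_notMem fun x hx => ?_, measure_empty]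
      · exact zero_le
      · have := hx.2
        rcases hA0 with h0 | h0
        · simp [h0] at this
        · rw [h0, ENNReal.zero_rpow_of_pos hexp] at this
          simp at this
    · push Not at hA0
      -- On T₂ the maximal function exceeds (t/G)^q, and k G^q = A^q k^(q/p) because 1 + (1/p - 1/q)
      -- q = q/p.
      set G := A * k ^ (1 / p - 1 / q) with hG
      have hG0 : G ≠ 0 := mul_ne_zero hA0.1 (by simp [hA0.2, hκ])
      have hGt : G ≠ ∞ := ENNReal.mul_ne_top hAt (ENNReal.rpow_ne_top_of_nonneg hexp.le hκ)
      have hs0 : (t / G) ^ q ≠ 0 := by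
        have : t / G ≠ 0 := (ENNReal.div_pos ht hGt).ne'
        simp [this, hq.le]
      have hst : (t / G) ^ q ≠ ∞ :=
        ENNReal.rpow_ne_top_of_nonneg hq.le (ENNReal.div_ne_top ht' hG0)
      refine (measure_mono ?_).trans ((meas_chainMax_gt_le h hs0 hst (κ := κ)).trans (le_of_eq ?_))
      · rintro x ⟨hxS, hx⟩
        refine ⟨hxS, ?_⟩
        rw [← mul_assoc, ← hG] at hx
        have h1 : t / G < chainMax ν κ lam r x ^ (1 / q) :=
          ENNReal.div_lt_of_lt_mul' hx
        have h2 := ENNReal.rpow_lt_rpow h1 hq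
        rwa [← ENNReal.rpow_mul, one_div_mul_cancel hq.ne', ENNReal.rpow_one] at h2
      · have e1 : k * G ^ q = A ^ q * k ^ (q / p) := by
          rw [hG, ENNReal.mul_rpow_of_nonneg _ _ hq.le, ← ENNReal.rpow_mul]
          have : k ^ (q / p) = k * k ^ ((1 / p - 1 / q) * q) := by
            conv_rhs => rw [← ENNReal.rpow_one k, ← ENNReal.rpow_mul, one_mul]
            rw [← ENNReal.rpow_add _ _ hA0.2 hκ]
            congr 1
            field_simp
            ring
          rw [this]; ring
        rw [ENNReal.div_rpow_of_nonneg _ _ hq.le, ← e1, div_eq_mul_inv, ENNReal.inv_div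
          (Or.inl (ENNReal.rpow_ne_top_of_nonneg hq.le hGt)) (Or.inl (by simp [hG0, hGt]))]
        simp only [div_eq_mul_inv]; ring
  refine hsub.trans ((measure_union_le _ _).trans ((add_le_add hm1 hm2).trans ?_))
  have e : weakConst D θ p q * (K ^ q * k ^ (q / p)) / t ^ q =
      2 * D * (A ^ q * k ^ (q / p) / t ^ q) := by
    rw [weakConst, hA, ENNReal.mul_rpow_of_nonneg (2 * C) K hq.le]
    simp only [div_eq_mul_inv]; ring
  rw [e, two_mul, add_mul]
  gcongr
  exact le_mul_of_one_le_left zero_le h.one_le_D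

end

end TwoWeight

/-! ### From weak L^q to L^s, s < q -/

namespace TwoWeight

lemma setLIntegral_Ioc_rpow {s t₀ : ℝ} (hs : 1 ≤ s) (ht₀ : 0 < t₀) :
    ∫⁻ t in Ioc 0 t₀, ENNReal.ofReal (t ^ (s - 1)) = ENNReal.ofReal (t₀ ^ s / s) := by
  rw [← ofReal_integral_eq_lintegral_ofReal]
  · rw [← intervalIntegral.integral_of_le ht₀.le, integral_rpow (Or.inl (by linarith))]
    rw [sub_add_cancel, Real.zero_rpow (by linarith), sub_zero]
  · exact (intervalIntegral.intervalIntegrable_rpow' (by linarith)).1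
  · filter_upwards [ae_restrict_mem measurableSet_Ioc] with t ht
    exact Real.rpow_nonneg ht.1.le _

lemma setLIntegral_Ioi_rpow {s t₀ : ℝ} (hs : s < 0) (ht₀ : 0 < t₀) :
    ∫⁻ t in Ioi t₀, ENNReal.ofReal (t ^ (s - 1)) = ENNReal.ofReal (t₀ ^ s / -s) := by
  rw [← ofReal_integral_eq_lintegral_ofReal]
  · rw [integral_Ioi_rpow_of_lt (by linarith) ht₀, sub_add_cancel, neg_div, div_neg]
  · exact integrableOn_Ioi_rpow_of_lt (by linarith) ht₀
  · filter_upwards [ae_restrict_mem measurableSet_Ioi] with t ht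
    exact Real.rpow_nonneg (ht₀.trans ht).le _

section

variable {α : Type*} [MeasurableSpace α] {ν : Measure α} {F : α → ℝ≥0∞} {W : ℝ≥0∞} {q s : ℝ}

lemma ae_lt_top_of_weak (hq : 0 < q) (hW : W ≠ ∞)
    (h : ∀ t : ℝ≥0∞, t ≠ 0 → t ≠ ∞ → ν {x | t < F x} ≤ W / t ^ q) : ∀ᵐ x ∂ν, F x < ∞ := by
  rw [ae_iff]
  refine le_antisymm (ge_of_tendsto' (x := atTop)
    (f := fun n : ℕ => W / ((n + 1 : ℕ) : ℝ≥0∞) ^ q) ?_ fun n => ?_) zero_le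
  · have h1 : Tendsto (fun n : ℕ => ((n + 1 : ℕ) : ℝ≥0∞) ^ q) atTop (𝓝 ∞) := by
      have := (ENNReal.continuous_rpow_const (y := q)).tendsto ∞ |>.comp
        (ENNReal.tendsto_nat_nhds_top.comp (tendsto_add_atTop_nat 1))
      rwa [ENNReal.top_rpow_of_pos hq] at this
    simpa using ENNReal.Tendsto.const_div (a := W) h1 (Or.inr hW)
  · refine le_trans (measure_mono ?_) (h _ (by simp) (ENNReal.natCast_ne_top _))
    intro x hx
    simp only [mem_ofPred_eq, not_lt, top_le_iff] at hx ⊢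
    exact hx ▸ ENNReal.natCast_lt_top _

lemma ae_eq_zero_of_weak (h : ∀ t : ℝ≥0∞, t ≠ 0 → t ≠ ∞ → ν {x | t < F x} = 0) :
    ∀ᵐ x ∂ν, F x = 0 := by
  have h1 : ∀ n : ℕ, ∀ᵐ x ∂ν, F x ≤ ((n + 1 : ℕ) : ℝ≥0∞)⁻¹ := fun n => by
    rw [ae_iff]
    simp only [not_le]
    exact h _ (ENNReal.inv_ne_zero.2 (ENNReal.natCast_ne_top _)) (by simp)
  filter_upwards [ae_all_iff.2 h1] with x hx
  exact le_antisymm (ge_of_tendsto'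
    (ENNReal.tendsto_inv_nat_nhds_zero.comp (tendsto_add_atTop_nat 1)) hx) zero_le

/-- A weak `L^q` bound on a finite measure space gives an `L^s` bound for `s < q`. -/
lemma lintegral_rpow_le_of_weak (hF : AEMeasurable F ν) (hν : ν univ ≠ ∞) (hs : 1 ≤ s)
    (hsq : s < q) (hW : W ≠ ∞)
    (h : ∀ t : ℝ≥0∞, t ≠ 0 → t ≠ ∞ → ν {x | t < F x} ≤ W / t ^ q) :
    (∫⁻ x, F x ^ s ∂ν) ^ (1 / s) ≤
      W ^ (1 / q) * ν univ ^ (1 / s - 1 / q) * ENNReal.ofReal (q / (q - s)) := by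
  have hs0 : 0 < s := by linarith
  have hq0 : 0 < q := by linarith
  have hexp : 0 < 1 / s - 1 / q := sub_pos.2 (one_div_lt_one_div_of_lt hs0 hsq)
  rcases eq_or_ne (ν univ) 0 with hν0 | hν0
  · rw [Measure.measure_univ_eq_zero.1 hν0]
    simp [hs0]
  rcases eq_or_ne W 0 with hW0 | hW0
  · have : ∀ᵐ x ∂ν, F x ^ s = 0 := by
      filter_upwards [ae_eq_zero_of_weak (F := F) (ν := ν) fun t ht ht' => by
        simpa [hW0] using h t ht ht'] with x hx
      rw [hx, ENNReal.zero_rpow_of_pos hs0]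
    rw [lintegral_congr_ae this]
    simp [hs0]
  set n := (ν univ).toReal with hn
  have hn0 : 0 < n := ENNReal.toReal_pos hν0 hν
  set w := W.toReal with hw
  have hw0 : 0 < w := ENNReal.toReal_pos hW0 hW
  have hνn : ν univ = ENNReal.ofReal n := (ENNReal.ofReal_toReal hν).symm
  have hWw : W = ENNReal.ofReal w := (ENNReal.ofReal_toReal hW).symm
  -- The level where the two bounds n and w t^(-q) for the distribution function coincide: n is used
  -- below it, the weak bound above it.
  set t₀ := (w / n) ^ (1 / q) with ht₀
  have ht₀0 : 0 < t₀ := by positivity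
  have ht₀q : n * t₀ ^ q = w := by
    rw [ht₀, ← Real.rpow_mul (by positivity), one_div_mul_cancel hq0.ne', Real.rpow_one]
    field_simp
  -- Finiteness almost everywhere allows the real-valued layer cake formula; `toReal` sends the
  -- remaining infinite values to 0, outside all superlevel sets at positive levels.
  have hfin := ae_lt_top_of_weak hq0 hW h
  have hlevel : ∀ t : ℝ, 0 < t →
      ν {a | t < (F a).toReal} ≤ ENNReal.ofReal w * ENNReal.ofReal (t ^ (-q)) := fun t ht => by
    refine (measure_mono fun x hx => ?_).trans
      ((h (ENNReal.ofReal t) (by simpa using ht) ENNReal.ofReal_ne_top).trans (le_of_eq ?_))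
    · exact ENNReal.ofReal_lt_iff_lt_toReal ht.le
        (fun hh => by simp [hh] at hx; linarith) |>.2 hx
    · rw [hWw, ENNReal.ofReal_rpow_of_pos ht, div_eq_mul_inv,
        ← ENNReal.ofReal_inv_of_pos (by positivity), Real.rpow_neg ht.le]
  have hmain : ∫⁻ x, F x ^ s ∂ν ≤ ENNReal.ofReal (n * t₀ ^ s * (q / (q - s))) := by
    have e1 : ∫⁻ x, F x ^ s ∂ν = ∫⁻ x, ENNReal.ofReal ((F x).toReal ^ s) ∂ν := by
      refine lintegral_congr_ae ?_
      filter_upwards [hfin] with x hx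
      rw [← ENNReal.ofReal_rpow_of_nonneg ENNReal.toReal_nonneg hs0.le,
        ENNReal.ofReal_toReal hx.ne]
    rw [e1, lintegral_rpow_eq_lintegral_meas_lt_mul ν
      (Eventually.of_forall fun x => ENNReal.toReal_nonneg) hF.ennreal_toReal hs0,
      ← Ioc_union_Ioi_eq_Ioi ht₀0.le, lintegral_union measurableSet_Ioi
        (Set.disjoint_left.2 fun x hx hx' => absurd hx.2 (not_le.2 hx'))]
    have b1 : ∫⁻ t in Ioc 0 t₀, ν {a | t < (F a).toReal} * ENNReal.ofReal (t ^ (s - 1)) ≤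
        ENNReal.ofReal (n * (t₀ ^ s / s)) := by
      rw [ENNReal.ofReal_mul hn0.le, ← setLIntegral_Ioc_rpow hs ht₀0, ← hνn,
        ← lintegral_const_mul' _ _ hν]
      refine lintegral_mono fun t => ?_
      gcongr
      exact subset_univ _
    have b2 : ∫⁻ t in Ioi t₀, ν {a | t < (F a).toReal} * ENNReal.ofReal (t ^ (s - 1)) ≤
        ENNReal.ofReal (w * (t₀ ^ (s - q) / (q - s))) := by
      rw [ENNReal.ofReal_mul hw0.le, show q - s = -(s - q) by ring,
        ← setLIntegral_Ioi_rpow (by linarith) ht₀0,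
        ← lintegral_const_mul' _ _ ENNReal.ofReal_ne_top]
      refine lintegral_mono_ae ?_
      filter_upwards [ae_restrict_mem measurableSet_Ioi] with t ht
      have ht0 : 0 < t := ht₀0.trans ht
      refine (mul_le_mul_left (hlevel t ht0) _).trans (le_of_eq ?_)
      rw [mul_assoc, ← ENNReal.ofReal_mul (by positivity), ← Real.rpow_add ht0]
      congr 3
      ring
    refine (mul_le_mul_right (add_le_add b1 b2) _).trans (le_of_eq ?_)
    have hqs : 0 < q - s := by linarith
    rw [← ENNReal.ofReal_add (by positivity) (by positivity), ← ENNReal.ofReal_mul hs0.le]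
    congr 1
    rw [Real.rpow_sub ht₀0, ← ht₀q]
    have : t₀ ^ q ≠ 0 := by positivity
    field_simp
    ring
  have hqs : 0 < q - s := by linarith
  refine (ENNReal.rpow_le_rpow hmain (by positivity)).trans ?_
  rw [hWw, hνn, ENNReal.ofReal_rpow_of_pos hw0, ENNReal.ofReal_rpow_of_pos hn0,
    ENNReal.ofReal_rpow_of_nonneg (by positivity) (by positivity),
    ← ENNReal.ofReal_mul (by positivity), ← ENNReal.ofReal_mul (by positivity)]
  refine ENNReal.ofReal_le_ofReal ?_
  rw [Real.mul_rpow (by positivity) (by positivity), Real.mul_rpow (by positivity) (by positivity),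
    ← Real.rpow_mul ht₀0.le, mul_one_div_cancel hs0.ne', Real.rpow_one]
  refine mul_le_mul (le_of_eq ?_) ?_ (by positivity) (by positivity)
  · rw [ht₀, Real.div_rpow hw0.le hn0.le, Real.rpow_sub hn0]
    field_simp
  -- The computation gives (q/(q-s))^(1/s); as the base is at least 1 and 1/s ≤ 1, the exponent can
  -- be dropped, leaving the factor 1/(q-s) of the theorem.
  · have h1 : 1 ≤ q / (q - s) := by rw [le_div_iff₀ hqs]; linarith
    calc (q / (q - s)) ^ (1 / s) ≤ (q / (q - s)) ^ (1 : ℝ) :=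
          Real.rpow_le_rpow_of_exponent_le h1 (by rw [div_le_one hs0]; exact hs)
      _ = _ := Real.rpow_one _

end

end TwoWeight

/-! ### Extended real values and ν-measurability of u -/

namespace TwoWeight

lemma measurable_ereal_abs : Measurable EReal.abs := by
  have : EReal.abs = fun x : EReal =>
      if x = ⊤ ∨ x = ⊥ then (⊤ : ℝ≥0∞) else ENNReal.ofReal |x.toReal| := by
    ext x
    induction x with
    | bot => simp
    | top => simp
    | coe x => simp [EReal.abs_def]
  rw [this]
  refine Measurable.ite ?_ measurable_const ?_
  · exact (measurableSet_singleton (⊤ : EReal)).union (measurableSet_singleton ⊥)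
  · exact ENNReal.measurable_ofReal.comp
      ((measurable_norm (α := ℝ)).comp measurable_ereal_toReal)

/-- At infinite a the right-hand side is infinite, so replacing u by `toReal` can only decrease
oscillations and the Poincaré inequality passes to the real-valued function. -/
lemma enorm_toReal_sub_le (a : EReal) (c : ℝ) : ‖a.toReal - c‖ₑ ≤ (a - (c : EReal)).abs := by
  induction a with
  | bot => simp
  | top => simp
  | coe x => rw [← EReal.coe_sub, EReal.abs_def, EReal.toReal_coe, Real.enorm_eq_ofReal_abs]

lemma abs_le_abs_sub_add (a : EReal) (c : ℝ) :
    a.abs ≤ (a - (c : EReal)).abs + ENNReal.ofReal |c| := by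
  induction a with
  | bot => simp
  | top => simp
  | coe x =>
    rw [← EReal.coe_sub, EReal.abs_def, EReal.abs_def,
      ← ENNReal.ofReal_add (abs_nonneg _) (abs_nonneg _)]
    refine ENNReal.ofReal_le_ofReal ?_
    simpa using abs_add_le (x - c) c

lemma measurable_abs_sub (c : ℝ) : Measurable fun a : EReal => (a - (c : EReal)).abs := by
  refine measurable_ereal_abs.comp ?_
  have : (fun a : EReal => a - (c : EReal)) = fun a => a + ((-c : ℝ) : EReal) := by
    ext a; rw [sub_eq_add_neg, EReal.coe_neg]
  rw [this]
  refine Continuous.measurable (continuous_iff_continuousAt.2 fun a => ?_)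
  exact (EReal.continuousAt_add (Or.inr (EReal.coe_ne_bot _)) (Or.inr (EReal.coe_ne_top _))).comp
    (continuousAt_id.prodMk continuousAt_const)

lemma MemLpOn.integrableOn_toReal {X : Type*} [MeasurableSpace X] {μ : Measure X} {u : X → EReal}
    {S : Set X} (hu : MemLpOn μ 1 S u) :
    IntegrableOn (fun y => (u y).toReal) S μ := by
  refine ⟨(measurable_ereal_toReal.comp_aemeasurable hu.1).aestronglyMeasurable, ?_⟩
  refine lt_of_le_of_lt (lintegral_mono fun y => ?_) hu.2
  rw [ENNReal.rpow_one]
  simpa using enorm_toReal_sub_le (u y) 0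

section

variable {X : Type*} [MetricSpace X] [MeasurableSpace X]
  {μ ν : Measure X} {E : Set X} {x₀ : X} {r : ℝ} {u : X → EReal}

/-- The function is lower semicontinuous: an open ball is exhausted by smaller concentric balls, and
each of these stays inside B(z, r) for z close to x. -/
lemma measurable_setLIntegral_ball [OpensMeasurableSpace X] (f : X → ℝ≥0∞) (r : ℝ) :
    Measurable fun x => ∫⁻ y in ball x r, f y ∂μ := by
  refine measurable_of_Ioi fun c => IsOpen.measurableSet (Metric.isOpen_iff.2 fun x hx => ?_)
  have hU : ball x r = ⋃ n : ℕ, ball x (r - ((n + 1 : ℕ) : ℝ)⁻¹) := by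
    ext y
    simp only [mem_iUnion, mem_ball]
    constructor
    · intro hy
      obtain ⟨n, hn⟩ := exists_nat_one_div_lt (sub_pos.2 hy)
      refine ⟨n, ?_⟩
      push_cast
      rw [one_div] at hn
      linarith
    · rintro ⟨n, hn⟩
      have : (0 : ℝ) < ((n + 1 : ℕ) : ℝ)⁻¹ := by positivity
      linarith
  have hmono : Monotone fun n : ℕ => ball x (r - ((n + 1 : ℕ) : ℝ)⁻¹) := fun m n hmn =>
    ball_subset_ball (by gcongr)
  have hx' : c < ∫⁻ y in ball x r, f y ∂μ := hx
  rw [hU, setLIntegral_iUnion_of_directed _ hmono.directed_le] at hx'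
  obtain ⟨n, hn⟩ := lt_iSup_iff.1 hx'
  refine ⟨((n + 1 : ℕ) : ℝ)⁻¹, by positivity, fun z hz => ?_⟩
  refine hn.trans_le (lintegral_mono_set (ball_subset_ball' ?_))
  rw [mem_ball, dist_comm] at hz
  linarith

lemma measurable_ballAvg [OpensMeasurableSpace X] (hu : MemL1Loc μ u) {r : ℝ} (hr : 0 < r) :
    Measurable fun x => ballAvg μ u x r := by
  have h : ∀ x, ballAvg μ u x r = (∫⁻ y in ball x r, 1 ∂μ).toReal⁻¹ *
      ((∫⁻ y in ball x r, ENNReal.ofReal (u y).toReal ∂μ).toReal -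
        (∫⁻ y in ball x r, ENNReal.ofReal (-(u y).toReal) ∂μ).toReal) := fun x => by
    rw [ballAvg, setAverage_eq, integral_eq_lintegral_pos_part_sub_lintegral_neg_part
      (hu x r hr).integrableOn_toReal, setLIntegral_one, smul_eq_mul, Measure.real]
  simp_rw [h]
  exact (measurable_setLIntegral_ball _ r).ennreal_toReal.inv.mul
    ((measurable_setLIntegral_ball _ r).ennreal_toReal.sub
      (measurable_setLIntegral_ball _ r).ennreal_toReal)

lemma LebesguePoints.tendsto_dyadic (h : LebesguePoints μ ν E u) (hr : 0 < r) :
    ∀ᵐ x ∂ν, x ∈ ball x₀ r ∩ E →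
      Tendsto (fun n : ℕ => (ballAvg μ u x (r / 2 ^ n) : EReal)) atTop (𝓝 (u x)) := by
  filter_upwards [h] with x hx hxE
  refine (hx hxE.2).comp (tendsto_nhdsWithin_iff.2 ⟨?_, Eventually.of_forall fun n => ?_⟩)
  · exact tendsto_const_nhds.div_atTop (tendsto_pow_atTop_atTop_of_one_lt one_lt_two)
  · exact div_pos hr (by positivity)

/-- Only μ-measurability of u is assumed. With respect to ν, u is measurable on B ∩ E as an almost
everywhere limit of the averages, which are Borel functions of the centre. -/
lemma aemeasurable_of_lebesguePoints [OpensMeasurableSpace X] (hu : MemL1Loc μ u)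
    (h : LebesguePoints μ ν E u)
    (hE : NullMeasurableSet E ν) (hr : 0 < r) :
    AEMeasurable u (ν.restrict (ball x₀ r ∩ E)) := by
  refine aemeasurable_of_tendsto_metrizable_ae (f := fun (n : ℕ) x =>
    (ballAvg μ u x (r / 2 ^ n) : EReal)) atTop (fun n => ?_) ?_
  · exact (measurable_coe_real_ereal.comp (measurable_ballAvg hu (by positivity))).aemeasurable
  · exact (ae_restrict_iff'₀ (measurableSet_ball.nullMeasurableSet.inter hE)).2 (h.tendsto_dyadic hr)

end

end TwoWeight

/-! ### Poincaré inequality and Θ; the estimate for s < q -/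

namespace TwoWeight

section

variable {X : Type*} [MetricSpace X] [MeasurableSpace X] {μ ν : Measure X}
  {E : Set X} {x₀ : X} {r lam : ℝ} {D θ : ℝ≥0∞} {p q α CP : ℝ} {u : X → EReal} {g : X → ℝ≥0∞}

/-- The measure `g^p dμ`. -/
noncomputable def gradMeasure (μ : Measure X) (p : ℝ) (g : X → ℝ≥0∞) : Measure X :=
  μ.withDensity fun y => g y ^ p

lemma gradMeasure_ball [OpensMeasurableSpace X] (x : X) (ρ : ℝ) :
    gradMeasure μ p g (ball x ρ) = ∫⁻ y in ball x ρ, g y ^ p ∂μ :=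
  withDensity_apply _ measurableSet_ball

lemma gradNorm_eq [OpensMeasurableSpace X] (x : X) (ρ : ℝ) :
    gradNorm μ p g x ρ = gradMeasure μ p g (ball x ρ) ^ (1 / p) := by
  rw [gradNorm, gradMeasure_ball]

lemma PoincareAt.osc_toReal_le [OpensMeasurableSpace X] {x : X} {σ : ℝ}
    (hP : PoincareAt μ p α lam CP u g x σ) (hp : 0 < p) :
    ⨍⁻ y in ball x σ, ‖(u y).toReal - ⨍ z in ball x σ, (u z).toReal ∂μ‖ₑ ∂μ ≤
      ENNReal.ofReal (CP * diam (ball x σ) ^ α) *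
        (gradMeasure μ p g (ball x (lam * σ)) ^ (1 / p) / μ (ball x (lam * σ)) ^ (1 / p)) := by
  rw [gradMeasure_ball, ← ENNReal.div_rpow_of_nonneg _ _ (by positivity), ← setLAverage_eq]
  refine le_trans ?_ hP
  rw [setLAverage_eq, setLAverage_eq]
  gcongr
  exact enorm_toReal_sub_le _ _

lemma le_theta {F : Set X} {x : X} (hx : x ∈ F) {ρ : ℝ} (hρ : 0 < ρ) (hρr : ρ ≤ r) :
    ENNReal.ofReal (ρ ^ α) * ν (ball x ρ) ^ (1 / q) / μ (ball x (lam * ρ)) ^ (1 / p) ≤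
      Theta μ ν F p q α lam r :=
  le_iSup₂_of_le ρ ⟨hρ, hρr⟩ (le_iSup₂_of_le x hx le_rfl)

lemma theta_mono {F F' : Set X} (hF : F ⊆ F') {r r' : ℝ} (hr : r ≤ r') :
    Theta μ ν F p q α lam r ≤ Theta μ ν F' p q α lam r' :=
  iSup₂_le fun _ hρ => iSup₂_le fun _ hx => le_theta (hF hx) hρ.1 (hρ.2.trans hr)

/-- Θ at scale ρ trades ρ^α μ(B(x, λρ))^(-1/p) for ν(B(x, ρ))^(-1/q), and enlarging ρ to σ only
increases the μ-mass. Allowing σ up to 2ρ treats the starting ball B(x₀, 2r) while using Θ only up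
to r. The diameter is at most 2σ ≤ 4ρ, hence 4^α. -/
lemma PoincareAt.osc_le_theta [OpensMeasurableSpace X] {F : Set X} {x : X} {ρ σ : ℝ}
    (hP : PoincareAt μ p α lam CP u g x σ) (hp : 0 < p) (hα : 0 < α) (hCP : 0 < CP)
    (hlam : 0 ≤ lam) (hx : x ∈ F) (hρ : 0 < ρ) (hρr : ρ ≤ r) (hρσ : ρ ≤ σ) (hσ : σ ≤ 2 * ρ)
    (hν : ν (ball x ρ) ≠ 0) (hν' : ν (ball x ρ) ≠ ∞) :
    ⨍⁻ y in ball x σ, ‖(u y).toReal - ⨍ z in ball x σ, (u z).toReal ∂μ‖ₑ ∂μ ≤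
      ENNReal.ofReal (CP * 4 ^ α) * Theta μ ν F p q α lam r *
        (ν (ball x ρ) ^ (-(1 / q)) * gradMeasure μ p g (ball x (lam * σ)) ^ (1 / p)) := by
  refine (hP.osc_toReal_le hp).trans ?_
  have hdiam : diam (ball x σ) ^ α ≤ 4 ^ α * ρ ^ α := by
    rw [← Real.mul_rpow (by norm_num) hρ.le]
    exact Real.rpow_le_rpow diam_nonneg ((diam_ball (hρ.le.trans hρσ)).trans (by linarith)) hα.le
  have h1 : ENNReal.ofReal (CP * diam (ball x σ) ^ α) ≤
      ENNReal.ofReal (CP * 4 ^ α) * ENNReal.ofReal (ρ ^ α) := by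
    rw [← ENNReal.ofReal_mul (by positivity), mul_assoc]
    exact ENNReal.ofReal_le_ofReal (mul_le_mul_of_nonneg_left hdiam hCP.le)
  have hT := le_theta (μ := μ) (ν := ν) (q := q) (p := p) (α := α) (lam := lam) hx hρ hρr
  have hn0 : ν (ball x ρ) ^ (1 / q) ≠ 0 := by simp [hν, hν']
  have hnt : ν (ball x ρ) ^ (1 / q) ≠ ∞ := ENNReal.rpow_ne_top_of_ne_zero hν hν'
  have h2 : ENNReal.ofReal (ρ ^ α) / μ (ball x (lam * σ)) ^ (1 / p) ≤
      Theta μ ν F p q α lam r * ν (ball x ρ) ^ (-(1 / q)) := by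
    rw [ENNReal.rpow_neg, ← div_eq_mul_inv, ENNReal.le_div_iff_mul_le (Or.inl hn0) (Or.inl hnt)]
    refine le_trans ?_ hT
    rw [ENNReal.mul_div_right_comm]
    gcongr
  calc _ ≤ ENNReal.ofReal (CP * 4 ^ α) * ENNReal.ofReal (ρ ^ α) *
        (gradMeasure μ p g (ball x (lam * σ)) ^ (1 / p) / μ (ball x (lam * σ)) ^ (1 / p)) := by
        gcongr
    _ = ENNReal.ofReal (CP * 4 ^ α) *
        (ENNReal.ofReal (ρ ^ α) / μ (ball x (lam * σ)) ^ (1 / p)) *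
        gradMeasure μ p g (ball x (lam * σ)) ^ (1 / p) := by
        simp only [div_eq_mul_inv]; ring
    _ ≤ ENNReal.ofReal (CP * 4 ^ α) * (Theta μ ν F p q α lam r * ν (ball x ρ) ^ (-(1 / q))) *
        gradMeasure μ p g (ball x (lam * σ)) ^ (1 / p) := by gcongr
    _ = _ := by ring

/-- The oscillation bounds with the constant given by `Theta`. -/
lemma OscBound.of_poincare [OpensMeasurableSpace X] (h : LocalDoubling μ ν E x₀ r lam D θ)
    (hp : 0 < p) (hα : 0 < α) (hCP : 0 < CP)
    (hint : ∀ x ∈ ball x₀ r ∩ E, ∀ ρ : ℝ, 0 < ρ → ρ ≤ r →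
      IntegrableOn (fun y => (u y).toReal) (ball x ρ) μ)
    (hint₂ : IntegrableOn (fun y => (u y).toReal) (ball x₀ (2 * r)) μ)
    (hP : ∀ x ∈ E, ∀ ρ : ℝ, 0 < ρ → ρ ≤ 2 * r → PoincareAt μ p α lam CP u g x ρ) :
    OscBound μ ν (gradMeasure μ p g) E x₀ r lam p q
      (ENNReal.ofReal (CP * 4 ^ α) * Theta μ ν (E ∩ ball x₀ r) p q α lam r)
      (fun y => (u y).toReal) where
  integrable := hint
  integrable_large := hint₂
  small x hx ρ hρ hρr := (hP x hx.2 ρ hρ (by linarith)).osc_le_theta hp hα hCP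
    (zero_le_one.trans h.one_le_lam) hx.symm hρ hρr le_rfl (by linarith) (h.pos x hx ρ hρ).2.ne'
    (h.lt_top x hx ρ hρ (h.radius_le hρr)).2.ne
  large := by
    have hr := h.r_pos
    rw [show 2 * lam * r = lam * (2 * r) by ring]
    exact (hP x₀ h.center_mem (2 * r) (by linarith) le_rfl).osc_le_theta hp hα hCP
      (zero_le_one.trans h.one_le_lam) h.center.symm hr le_rfl (by linarith) le_rfl
      (h.pos x₀ h.center r hr).2.ne' (h.lt_top x₀ h.center r hr (h.radius_le le_rfl)).2.ne

/-- If the gradient vanishes on the large ball, the oscillation vanishes. -/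
lemma OscBound.of_gradMeasure_eq_zero [OpensMeasurableSpace X]
    (h : LocalDoubling μ ν E x₀ r lam D θ) (hp : 0 < p)
    (hint : ∀ x ∈ ball x₀ r ∩ E, ∀ ρ : ℝ, 0 < ρ → ρ ≤ r →
      IntegrableOn (fun y => (u y).toReal) (ball x ρ) μ)
    (hint₂ : IntegrableOn (fun y => (u y).toReal) (ball x₀ (2 * r)) μ)
    (hP : ∀ x ∈ E, ∀ ρ : ℝ, 0 < ρ → ρ ≤ 2 * r → PoincareAt μ p α lam CP u g x ρ)
    (h0 : gradMeasure μ p g (ball x₀ (2 * lam * r)) = 0) :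
    OscBound μ ν (gradMeasure μ p g) E x₀ r lam p q 0 (fun y => (u y).toReal) := by
  have hp' : 0 < 1 / p := by positivity
  have hr := h.r_pos
  refine ⟨hint, hint₂, fun x hx ρ hρ hρr => ?_, ?_⟩
  · refine ((hP x hx.2 ρ hρ (by linarith)).osc_toReal_le hp).trans (le_of_eq ?_)
    rw [measure_mono_null (h.ball_subset hx hρr) h0, ENNReal.zero_rpow_of_pos hp']
    simp
  · refine ((hP x₀ h.center_mem (2 * r) (by linarith) le_rfl).osc_toReal_le hp).trans
      (le_of_eq ?_)
    rw [show lam * (2 * r) = 2 * lam * r by ring, h0, ENNReal.zero_rpow_of_pos hp']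
    simp

/-- The strong estimate for exponents `s < q`. -/
lemma oscNorm_le_of_lt [OpensMeasurableSpace X] (h : LocalDoubling μ ν E x₀ r lam D θ)
    (hp : 0 < p) (hpq : p < q) {s : ℝ} (hs : 1 ≤ s) (hsq : s < q) {K : ℝ≥0∞} (hK : K ≠ ∞)
    (hf : OscBound μ ν (gradMeasure μ p g) E x₀ r lam p q K (fun y => (u y).toReal))
    (hκ : gradMeasure μ p g (ball x₀ (2 * lam * r)) ≠ ∞)
    (hE : NullMeasurableSet E ν) (hu : MemL1Loc μ u) (hL : LebesguePoints μ ν E u) :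
    oscNorm μ ν E s u x₀ r ≤ weakConst D θ p q ^ (1 / q) * K * gradNorm μ p g x₀ (2 * lam * r) *
      ν (ball x₀ r ∩ E) ^ (1 / s - 1 / q) * ENNReal.ofReal (q / (q - s)) := by
  have hq : 0 < q := hp.trans hpq
  have hr := h.r_pos
  have hW : weakConst D θ p q * (K ^ q * gradMeasure μ p g (ball x₀ (2 * lam * r)) ^ (q / p)) ≠ ∞ :=
    ENNReal.mul_ne_top (weakConst_ne_top h.D_ne_top h.θ_lt_one hp hpq)
      (ENNReal.mul_ne_top (ENNReal.rpow_ne_top_of_nonneg hq.le hK)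
        (ENNReal.rpow_ne_top_of_nonneg (by positivity) hκ))
  have hmeas := aemeasurable_of_lebesguePoints hu hL hE hr (x₀ := x₀)
  have hS : NullMeasurableSet (ball x₀ r ∩ E) ν := measurableSet_ball.nullMeasurableSet.inter hE
  have hfin : (ν.restrict (ball x₀ r ∩ E)) univ ≠ ∞ := by
    rw [Measure.restrict_apply_univ]
    exact ne_top_of_le_ne_top (h.lt_top x₀ h.center r hr (h.radius_le le_rfl)).2.ne
      (measure_mono inter_subset_left)
  have key := lintegral_rpow_le_of_weak (ν := ν.restrict (ball x₀ r ∩ E))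
    ((measurable_abs_sub (ballAvg μ u x₀ r)).comp_aemeasurable hmeas) hfin hs hsq hW
    (fun t ht ht' => by
      rw [Measure.restrict_apply₀' hS]
      refine (measure_mono fun x hx => ?_).trans
        (meas_abs_sub_gt_le h hp hpq hf hK hκ (hL.tendsto_dyadic hr) ht ht')
      exact ⟨hx.2, hx.1⟩)
  refine key.trans (le_of_eq ?_)
  rw [Measure.restrict_apply_univ, gradNorm_eq, ENNReal.mul_rpow_of_nonneg _ _ (by positivity),
    ENNReal.mul_rpow_of_nonneg _ _ (by positivity), ← ENNReal.rpow_mul, ← ENNReal.rpow_mul,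
    mul_one_div_cancel hq.ne', ENNReal.rpow_one, show q / p * (1 / q) = 1 / p by field_simp]
  ring

lemma memLpOn_of_oscNorm_lt_top {s : ℝ} (hs : 1 ≤ s)
    (hu : AEMeasurable u (ν.restrict (ball x₀ r ∩ E)))
    (hν : ν (ball x₀ r ∩ E) ≠ ∞) (h : oscNorm μ ν E s u x₀ r < ∞) :
    MemLpOn ν s (ball x₀ r ∩ E) u := by
  have hs0 : 0 < s := by linarith
  refine ⟨hu, ?_⟩
  set c := ballAvg μ u x₀ r
  have h1 : ∫⁻ y in ball x₀ r ∩ E, (u y - (c : EReal)).abs ^ s ∂ν < ∞ := by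
    rwa [oscNorm, ENNReal.rpow_lt_top_iff_of_pos (by positivity)] at h
  calc ∫⁻ y in ball x₀ r ∩ E, (u y).abs ^ s ∂ν
      ≤ ∫⁻ y in ball x₀ r ∩ E, 2 ^ (s - 1) *
        ((u y - (c : EReal)).abs ^ s + ENNReal.ofReal |c| ^ s) ∂ν := by
        refine lintegral_mono fun y => ?_
        exact (ENNReal.rpow_le_rpow (abs_le_abs_sub_add (u y) c) hs0.le).trans
          (ENNReal.rpow_add_le_mul_rpow_add_rpow _ _ hs)
    _ < ∞ := by
        have h2 : (2 : ℝ≥0∞) ^ (s - 1) ≠ ∞ :=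
          ENNReal.rpow_ne_top_of_nonneg (by linarith) (by simp)
        rw [lintegral_const_mul' _ _ h2, lintegral_add_right _ measurable_const]
        refine ENNReal.mul_lt_top h2.lt_top (ENNReal.add_lt_top.2 ⟨h1, ?_⟩)
        rw [setLIntegral_const]
        exact ENNReal.mul_lt_top (ENNReal.rpow_lt_top_of_nonneg hs0.le ENNReal.ofReal_ne_top)
          hν.lt_top

end

end TwoWeight

/-! ### Truncations and their Lebesgue points -/

namespace TwoWeight

lemma abs_clamp_sub_clamp_le (l k a b : ℝ) :
    |max l (min a k) - max l (min b k)| ≤ |a - b| := by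
  rw [max_comm l, max_comm l]
  refine (abs_max_sub_max_le_abs _ _ _).trans ?_
  have := abs_min_sub_min_le_max a k b k
  simpa using this

section

variable {X : Type*} {u : X → EReal} {l k : ℝ}

lemma trunc_eq_coe {y : X} {a : ℝ} (ha : u y = a) :
    trunc u l k y = ((max l (min a k) : ℝ) : EReal) := by
  rw [trunc, ha]
  exact (EReal.coe_strictMono.monotone.map_max.trans
    (by rw [EReal.coe_strictMono.monotone.map_min])).symm

lemma coe_toReal_trunc (hlk : l < k) (y : X) :
    (((trunc u l k y).toReal : ℝ) : EReal) = trunc u l k y := by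
  have h1 : (l : EReal) ≤ trunc u l k y := le_max_left _ _
  have h2 : trunc u l k y ≤ (k : EReal) :=
    max_le (EReal.coe_le_coe_iff.2 hlk.le) (min_le_right _ _)
  exact EReal.coe_toReal (ne_top_of_le_ne_top (EReal.coe_ne_top k) h2)
    (ne_bot_of_le_ne_bot (EReal.coe_ne_bot l) h1)

lemma toReal_trunc_mem (hlk : l < k) (y : X) : (trunc u l k y).toReal ∈ Icc l k := by
  constructor
  · rw [← EReal.coe_le_coe_iff, coe_toReal_trunc hlk]
    exact le_max_left _ _
  · rw [← EReal.coe_le_coe_iff, coe_toReal_trunc hlk]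
    exact max_le (EReal.coe_le_coe_iff.2 hlk.le) (min_le_right _ _)

variable [MeasurableSpace X] {μ : Measure X} {A : Set X}

lemma aemeasurable_trunc (hu : AEMeasurable u (μ.restrict A)) :
    AEMeasurable (trunc u l k) (μ.restrict A) :=
  aemeasurable_const.max (hu.min aemeasurable_const)

lemma integrableOn_toReal_trunc (hlk : l < k) (hu : AEMeasurable u (μ.restrict A))
    (hA : μ A ≠ ∞) : IntegrableOn (fun y => (trunc u l k y).toReal) A μ := by
  have : IsFiniteMeasure (μ.restrict A) := ⟨by simpa using hA.lt_top⟩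
  refine Integrable.of_bound
    (measurable_ereal_toReal.comp_aemeasurable (aemeasurable_trunc hu)).aestronglyMeasurable
    (max |l| |k|) ?_
  exact Eventually.of_forall fun y => abs_le_max_abs_abs (toReal_trunc_mem hlk y).1
    (toReal_trunc_mem hlk y).2

lemma MemLpOn.ae_eq_coe (hu : MemLpOn μ 1 A u) :
    ∀ᵐ y ∂μ.restrict A, u y = ((u y).toReal : EReal) := by
  have h := hu.2
  simp only [ENNReal.rpow_one] at h
  filter_upwards [ae_lt_top' (measurable_ereal_abs.comp_aemeasurable hu.1) h.ne] with y hy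
  have hy' : (u y).abs < ∞ := hy
  refine (EReal.coe_toReal ?_ ?_).symm <;> intro hh <;> simp [hh] at hy'

lemma setLAverage_add_const {F : X → ℝ≥0∞} (c : ℝ≥0∞) (h0 : μ A ≠ 0) (hA : μ A ≠ ∞) :
    ⨍⁻ y in A, (F y + c) ∂μ = ⨍⁻ y in A, F y ∂μ + c := by
  rw [setLAverage_eq, setLAverage_eq, lintegral_add_right _ measurable_const, setLIntegral_const,
    ENNReal.add_div, ENNReal.mul_div_cancel_right h0 hA]

lemma setLAverage_mono_ae {F G : X → ℝ≥0∞} (h : ∀ᵐ y ∂μ.restrict A, F y ≤ G y) :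
    ⨍⁻ y in A, F y ∂μ ≤ ⨍⁻ y in A, G y ∂μ := by
  rw [setLAverage_eq, setLAverage_eq]
  gcongr ?_ / _
  exact lintegral_mono_ae h

end

section

variable {X : Type*} [MetricSpace X] [MeasurableSpace X] [OpensMeasurableSpace X]
  {μ ν κ : Measure X}
  {E : Set X} {x₀ : X} {r lam : ℝ} {D θ : ℝ≥0∞} {p q : ℝ} {u : X → EReal}
  {K : ℝ≥0∞}

/-- Truncations inherit the Lebesgue point property, because mean oscillations tend to zero
at almost every point. -/
lemma tendsto_average_trunc (h : LocalDoubling μ ν E x₀ r lam D θ)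
    (hp : 0 < p) (hpq : p < q) (hK : K ≠ ∞)
    (hf : OscBound μ ν κ E x₀ r lam p q K (fun y => (u y).toReal))
    (hκ : κ (ball x₀ (2 * lam * r)) ≠ ∞)
    (hu : MemL1Loc μ u) (hL : LebesguePoints μ ν E u) {l k : ℝ} (hlk : l < k) :
    ∀ᵐ x ∂ν, x ∈ ball x₀ r ∩ E → Tendsto
      (fun n : ℕ => ((⨍ z in ball x (r / 2 ^ n), (trunc u l k z).toReal ∂μ : ℝ) : EReal))
      atTop (𝓝 (trunc u l k x)) := by
  have hr := h.r_pos
  have hq : 0 < q := hp.trans hpq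
  have hexp : 0 < 1 / p - 1 / q := sub_pos.2 (one_div_lt_one_div_of_lt hp hpq)
  filter_upwards [hL.tendsto_dyadic (x₀ := x₀) hr, ae_chainMax_lt_top h hκ] with x hx1 hx2 hxS
  have hM := hx2 hxS
  have hlim := hx1 hxS
  have hsum := tsum_chain_le h hp hpq hκ hxS hM
  have hG : geomConst D θ (1 / p - 1 / q) (1 / q) ≠ ∞ :=
    geomConst_ne_top h.D_ne_top h.θ_lt_one hexp (by positivity)
  have hB : κ (ball x₀ (2 * lam * r)) ^ (1 / p - 1 / q) * chainMax ν κ lam r x ^ (1 / q) ≠ ∞ :=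
    ENNReal.mul_ne_top (ENNReal.rpow_ne_top_of_nonneg hexp.le hκ)
      (ENNReal.rpow_ne_top_of_nonneg (by positivity) hM.ne)
  -- Where the maximal function is finite, the pointwise chain estimate forces u(x) to be finite.
  obtain ⟨U, hU⟩ : ∃ U : ℝ, u x = U := by
    have h1 := abs_sub_setAverage_le h hp hpq hf hκ hxS hM hlim
    have h2 : (u x - ((⨍ z in ball x₀ r, (u z).toReal ∂μ : ℝ) : EReal)).abs ≠ ∞ := by
      refine ne_top_of_le_ne_top (ENNReal.mul_ne_top (ENNReal.mul_ne_top
        (chainConst_ne_top h.D_ne_top h.θ_lt_one hp hpq) hK)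
        (ENNReal.add_ne_top.2 ⟨ENNReal.mul_ne_top ?_ ?_, hB⟩)) h1
      · exact ENNReal.rpow_ne_top_of_ne_zero (h.pos x₀ h.center r hr).2.ne'
          (h.lt_top x₀ h.center r hr (h.radius_le le_rfl)).2.ne
      · exact ENNReal.rpow_ne_top_of_nonneg (by positivity) hκ
    induction hux : u x with
    | bot => simp [hux] at h2
    | top => simp [hux] at h2
    | coe a => exact ⟨a, rfl⟩
  -- The oscillations are dominated by the terms of a convergent chain series. Together with
  -- convergence of the averages this gives mean convergence of u to U, which the 1-Lipschitz clamp
  -- preserves; convergence of averages alone would not suffice.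
  have hosc : Tendsto (fun n : ℕ => ⨍⁻ y in ball x (r / 2 ^ n),
      ‖(u y).toReal - ⨍ z in ball x (r / 2 ^ n), (u z).toReal ∂μ‖ₑ ∂μ) atTop (𝓝 0) := by
    have h1 := ENNReal.tendsto_atTop_zero_of_tsum_ne_top
      (ne_top_of_le_ne_top (ENNReal.mul_ne_top hG hB) hsum)
    have h2 := ENNReal.Tendsto.const_mul (a := K) h1 (Or.inr hK)
    rw [mul_zero] at h2
    exact tendsto_of_tendsto_of_tendsto_of_le_of_le tendsto_const_nhds h2 (fun _ => zero_le)
      fun n => hf.small x hxS _ (by positivity) (div_two_pow_le hr n)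
  rw [hU] at hlim
  have hlim' : Tendsto (fun n : ℕ => ‖ballAvg μ u x (r / 2 ^ n) - U‖ₑ) atTop (𝓝 0) := by
    have h1 := (EReal.tendsto_coe.1 hlim).sub_const U
    rw [sub_self] at h1
    simpa using h1.enorm
  rw [trunc_eq_coe hU, EReal.tendsto_coe, tendsto_iff_edist_tendsto_0]
  have hadd := hosc.add hlim'
  rw [add_zero] at hadd
  refine tendsto_of_tendsto_of_tendsto_of_le_of_le tendsto_const_nhds hadd (fun _ => zero_le)
    fun n => ?_
  have hρ : 0 < r / 2 ^ n := by positivity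
  have hρ' := div_two_pow_le hr n
  have h0 := (h.pos x hxS _ hρ).1.ne'
  have hA := (h.lt_top x hxS _ hρ (h.radius_le hρ')).1.ne
  rw [edist_eq_enorm_sub]
  refine (enorm_setAverage_sub_le _ (integrableOn_toReal_trunc hlk (hu x _ hρ).1 hA) h0 hA).trans ?_
  rw [← setLAverage_add_const _ h0 hA]
  refine setLAverage_mono_ae ?_
  filter_upwards [(hu x _ hρ).ae_eq_coe] with y hy
  rw [trunc_eq_coe hy, EReal.toReal_coe]
  calc ‖max l (min (u y).toReal k) - max l (min U k)‖ₑ ≤ ‖(u y).toReal - U‖ₑ := by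
        rw [Real.enorm_eq_ofReal_abs, Real.enorm_eq_ofReal_abs]
        exact ENNReal.ofReal_le_ofReal (abs_clamp_sub_clamp_le _ _ _ _)
    _ = ‖((u y).toReal - ballAvg μ u x (r / 2 ^ n)) + (ballAvg μ u x (r / 2 ^ n) - U)‖ₑ := by
        rw [sub_add_sub_cancel]
    _ ≤ _ := enorm_add_le _ _

end

end TwoWeight

/-! ### Level sets and the weak estimate for truncations -/

namespace TwoWeight

/-- The clamp of `a` to `[l, k]` is at least as close to `l` as `a` is to a point `c ≤ l`. -/
lemma abs_clamp_sub_left_le {l k a c : ℝ} (hc : c ≤ l) :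
    |max l (min a k) - l| ≤ |a - c| := by
  rw [abs_of_nonneg (sub_nonneg.2 (le_max_left _ _)), sub_le_iff_le_add]
  have h1 := abs_nonneg (a - c)
  have h2 := le_abs_self (a - c)
  exact max_le (by linarith) ((min_le_left _ _).trans (by linarith))

lemma abs_clamp_sub_right_le {l k a c : ℝ} (hlk : l < k) (hc : k ≤ c) :
    |max l (min a k) - k| ≤ |a - c| := by
  rw [abs_of_nonpos (sub_nonpos.2 (max_le hlk.le (min_le_right _ _))), neg_sub,
    sub_le_iff_le_add, ← sub_le_iff_le_add']
  have h1 := abs_nonneg (a - c)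
  have h2 := neg_abs_le (a - c)
  exact (le_min (by linarith) (by linarith)).trans (le_max_right _ _)

section

variable {X : Type*} {u : X → EReal} {c t : ℝ}

/-- The dyadic-type level set `{t < |u - c| < 2t}`. -/
def levelSet (u : X → EReal) (c t : ℝ) : Set X :=
  {y | ENNReal.ofReal t < (u y - (c : EReal)).abs ∧
    (u y - (c : EReal)).abs < ENNReal.ofReal (2 * t)}

lemma mem_levelSet_of_coe {y : X} {a : ℝ} (ha : u y = a) (ht : 0 ≤ t) (h1 : t < |a - c|)
    (h2 : |a - c| < 2 * t) : y ∈ levelSet u c t := by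
  rw [levelSet, mem_ofPred_eq, ha, ← EReal.coe_sub, EReal.abs_def]
  exact ⟨(ENNReal.ofReal_lt_ofReal_iff_of_nonneg ht).2 h1,
    (ENNReal.ofReal_lt_ofReal_iff_of_nonneg (abs_nonneg _)).2 h2⟩

/-- This localises the gradient of a truncation: strict bounds l < u < k make u finite, so the level
set condition only has to be checked on real values. -/
lemma truncGrad_le_indicator {g : X → ℝ≥0∞} {l k : ℝ}
    (h : ∀ a : ℝ, l < a → a < k → t < |a - c| ∧ |a - c| < 2 * t) (ht : 0 ≤ t) (y : X) :
    truncGrad u g l k y ≤ (levelSet u c t).indicator g y := by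
  refine indicator_le_indicator_of_subset (fun y hy => ?_) (fun _ => zero_le) y
  obtain ⟨h1, h2⟩ := hy
  have hcoe : ((u y).toReal : EReal) = u y := EReal.coe_toReal h2.ne_top h1.ne_bot
  rw [← hcoe, EReal.coe_lt_coe_iff] at h1 h2
  exact mem_levelSet_of_coe hcoe.symm ht (h _ h1 h2).1 (h _ h1 h2).2

/-- A deviation of at least 2t is upward or downward, and the truncation on that side is saturated
at its far endpoint. Infinite values of u are included. -/
lemma trunc_of_two_mul_le_abs (ht : 0 < t)
    {y : X} (hy : ENNReal.ofReal (2 * t) ≤ (u y - (c : EReal)).abs) :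
    trunc u (c + t) (c + 2 * t) y = ((c + 2 * t : ℝ) : EReal) ∨
      trunc u (c - 2 * t) (c - t) y = ((c - 2 * t : ℝ) : EReal) := by
  induction huy : u y with
  | bot =>
    right
    rw [trunc, huy]
    simp
  | top =>
    left
    rw [trunc, huy]
    simp only [le_top, inf_of_le_right]
    exact max_eq_right (EReal.coe_le_coe_iff.2 (by linarith))
  | coe a =>
    rw [huy, ← EReal.coe_sub, EReal.abs_def, ENNReal.ofReal_le_ofReal_iff (abs_nonneg _)] at hy
    rw [trunc_eq_coe huy, trunc_eq_coe huy, EReal.coe_eq_coe_iff, EReal.coe_eq_coe_iff]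
    rcases le_abs'.1 hy with h | h
    · right
      rw [min_eq_left (by linarith), max_eq_left (by linarith)]
    · left
      rw [min_eq_right (by linarith), max_eq_right (by linarith)]

end

/-- Here e is the endpoint of [l, k] nearer to c. The truncation leaves e only where u is far from
c, so its average stays within one mean oscillation of e. -/
lemma enorm_average_trunc_sub_le {X : Type*} [MetricSpace X] [MeasurableSpace X] {μ : Measure X}
    {x₀ : X} {r : ℝ} {u : X → EReal} {l k e c : ℝ} (hlk : l < k)
    (hclamp : ∀ a : ℝ, |max l (min a k) - e| ≤ |a - c|)
    (hu : MemLpOn μ 1 (ball x₀ r) u) (h0 : μ (ball x₀ r) ≠ 0) (hA : μ (ball x₀ r) ≠ ∞) :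
    ‖(⨍ z in ball x₀ r, (trunc u l k z).toReal ∂μ) - e‖ₑ ≤
      ⨍⁻ y in ball x₀ r, ‖(u y).toReal - c‖ₑ ∂μ := by
  refine (enorm_setAverage_sub_le _ (integrableOn_toReal_trunc hlk hu.1 hA) h0 hA).trans ?_
  refine setLAverage_mono_ae ?_
  filter_upwards [hu.ae_eq_coe] with y hy
  rw [trunc_eq_coe hy, EReal.toReal_coe, Real.enorm_eq_ofReal_abs, Real.enorm_eq_ofReal_abs]
  exact ENNReal.ofReal_le_ofReal (hclamp _)

section

variable {X : Type*} [MetricSpace X] [MeasurableSpace X] [OpensMeasurableSpace X]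
  {μ ν : Measure X}
  {E : Set X} {x₀ : X} {r lam : ℝ} {D θ : ℝ≥0∞} {p q α CP : ℝ} {u : X → EReal} {g : X → ℝ≥0∞}
  {K : ℝ≥0∞}

/-- Weak type estimate for one truncation, on the set where the truncation takes the value `e'`,
when the average of the truncation is close to the opposite value `e`. -/
lemma meas_trunc_eq_le (h : LocalDoubling μ ν E x₀ r lam D θ)
    (hp : 0 < p) (hpq : p < q) {l k : ℝ}
    (hf : OscBound μ ν (gradMeasure μ p (truncGrad u g l k)) E x₀ r lam p q K
      (fun y => (trunc u l k y).toReal)) (hK : K ≠ ∞)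
    (hκ : gradMeasure μ p (truncGrad u g l k) (ball x₀ (2 * lam * r)) ≠ ∞)
    (hL : ∀ᵐ x ∂ν, x ∈ ball x₀ r ∩ E → Tendsto
      (fun n : ℕ => ((⨍ z in ball x (r / 2 ^ n), (trunc u l k z).toReal ∂μ : ℝ) : EReal))
      atTop (𝓝 (trunc u l k x)))
    {e e' t : ℝ} (ht : 0 < t) (hee : |e' - e| = t)
    (havg : ‖(⨍ z in ball x₀ r, (trunc u l k z).toReal ∂μ) - e‖ₑ ≤ ENNReal.ofReal (t / 2)) :
    ν {x | x ∈ ball x₀ r ∩ E ∧ trunc u l k x = (e' : EReal)} ≤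
      weakConst D θ p q *
        (K ^ q * gradMeasure μ p (truncGrad u g l k) (ball x₀ (2 * lam * r)) ^ (q / p)) /
        ENNReal.ofReal (t / 4) ^ q := by
  refine (measure_mono ?_).trans (meas_abs_sub_gt_le h hp hpq hf hK hκ hL
    (t := ENNReal.ofReal (t / 4)) (by simpa using ht) ENNReal.ofReal_ne_top)
  rintro x ⟨hxS, hx⟩
  -- The average is within t/2 of e and e' is at distance t from e, so e' is at least t/2 from the
  -- average; t/4 gives the strict inequality.
  refine ⟨hxS, ?_⟩
  rw [hx, ← EReal.coe_sub, EReal.abs_def]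
  rw [Real.enorm_eq_ofReal_abs, ENNReal.ofReal_le_ofReal_iff (by positivity)] at havg
  refine (ENNReal.ofReal_lt_ofReal_iff_of_nonneg (by positivity)).2 ?_
  set a := ⨍ z in ball x₀ r, (trunc u l k z).toReal ∂μ
  have h1 := abs_sub_le e' a e
  rw [hee] at h1
  linarith

lemma gradMeasure_mono {g g' : X → ℝ≥0∞} (hp : 0 < p) (hg : ∀ y, g y ≤ g' y) (x : X) (ρ : ℝ) :
    gradMeasure μ p g (ball x ρ) ≤ gradMeasure μ p g' (ball x ρ) := by
  rw [gradMeasure_ball, gradMeasure_ball]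
  exact lintegral_mono fun y => ENNReal.rpow_le_rpow (hg y) hp.le

/-- Estimate of the level set `{|u - c| ≥ 2t}` by the gradient on `{t < |u - c| < 2t}`, for `t`
large compared to the mean oscillation. -/
lemma meas_level_le (h : LocalDoubling μ ν E x₀ r lam D θ)
    (hp : 0 < p) (hpq : p < q) (hα : 0 < α) (hCP : 0 < CP)
    (hΘ : Theta μ ν (E ∩ ball x₀ r) p q α lam r ≠ ∞)
    (hP : ∀ x ∈ E, ∀ ρ : ℝ, 0 < ρ → ρ ≤ 2 * r → PoincareAt μ p α lam CP u g x ρ)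
    (hT : ∀ x ∈ E, ∀ ρ : ℝ, 0 < ρ → ρ ≤ 2 * r → TruncPoincareAt μ p α lam CP u g x ρ)
    (hκ : gradMeasure μ p g (ball x₀ (2 * lam * r)) ≠ ∞)
    (hu : MemL1Loc μ u) (hL : LebesguePoints μ ν E u) {t : ℝ} (ht : 0 < t)
    (hm : 2 * ⨍⁻ y in ball x₀ r, ‖(u y).toReal - ballAvg μ u x₀ r‖ₑ ∂μ < ENNReal.ofReal t) :
    ν {x | x ∈ ball x₀ r ∩ E ∧ ENNReal.ofReal (2 * t) ≤
        (u x - (ballAvg μ u x₀ r : EReal)).abs} ≤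
      2 * (weakConst D θ p q *
        ((ENNReal.ofReal (CP * 4 ^ α) * Theta μ ν (E ∩ ball x₀ r) p q α lam r) ^ q *
          gradMeasure μ p ((levelSet u (ballAvg μ u x₀ r) t).indicator g)
            (ball x₀ (2 * lam * r)) ^ (q / p)) / ENNReal.ofReal (t / 4) ^ q) := by
  set c := ballAvg μ u x₀ r with hc
  set K := ENNReal.ofReal (CP * 4 ^ α) * Theta μ ν (E ∩ ball x₀ r) p q α lam r with hKdef
  have hK : K ≠ ∞ := ENNReal.mul_ne_top ENNReal.ofReal_ne_top hΘ
  have hr := h.r_pos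
  have hlam := h.one_le_lam
  have hq : 0 < q := hp.trans hpq
  have hμ0 := (h.pos x₀ h.center r hr).1.ne'
  have hμt := (h.lt_top x₀ h.center r hr (h.radius_le le_rfl)).1.ne
  have hint : ∀ x ∈ ball x₀ r ∩ E, ∀ ρ : ℝ, 0 < ρ → ρ ≤ r →
      IntegrableOn (fun y => (u y).toReal) (ball x ρ) μ :=
    fun x _ ρ hρ _ => (hu x ρ hρ).integrableOn_toReal
  have hf := OscBound.of_poincare (q := q) h hp hα hCP hint
    (hu x₀ (2 * r) (by linarith)).integrableOn_toReal hP
  have hhalf : ⨍⁻ y in ball x₀ r, ‖(u y).toReal - c‖ₑ ∂μ ≤ ENNReal.ofReal (t / 2) := by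
    rw [ENNReal.ofReal_div_of_pos two_pos, ENNReal.ofReal_ofNat,
      ENNReal.le_div_iff_mul_le (by simp) (by simp), mul_comm]
    exact hm.le
  have main : ∀ l k e e' : ℝ, l < k →
      (∀ a : ℝ, |max l (min a k) - e| ≤ |a - c|) →
      (∀ a : ℝ, l < a → a < k → t < |a - c| ∧ |a - c| < 2 * t) → |e' - e| = t →
      ν {x | x ∈ ball x₀ r ∩ E ∧ trunc u l k x = (e' : EReal)} ≤
        weakConst D θ p q * (K ^ q * gradMeasure μ p ((levelSet u c t).indicator g)
            (ball x₀ (2 * lam * r)) ^ (q / p)) / ENNReal.ofReal (t / 4) ^ q := by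
    intro l k e e' hlk hclamp hlev hee
    have hmono : gradMeasure μ p (truncGrad u g l k) (ball x₀ (2 * lam * r)) ≤
        gradMeasure μ p ((levelSet u c t).indicator g) (ball x₀ (2 * lam * r)) :=
      gradMeasure_mono hp (fun y => truncGrad_le_indicator hlev ht.le y) _ _
    have hκ' : gradMeasure μ p (truncGrad u g l k) (ball x₀ (2 * lam * r)) ≠ ∞ :=
      ne_top_of_le_ne_top hκ (hmono.trans
        (gradMeasure_mono hp (fun y => indicator_le_self _ _ y) _ _))
    have hft : OscBound μ ν (gradMeasure μ p (truncGrad u g l k)) E x₀ r lam p q K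
        (fun y => (trunc u l k y).toReal) :=
      OscBound.of_poincare h hp hα hCP
        (fun x hx ρ hρ hρr => integrableOn_toReal_trunc hlk (hu x ρ hρ).1
          (h.lt_top x hx ρ hρ (h.radius_le hρr)).1.ne)
        (integrableOn_toReal_trunc hlk (hu x₀ (2 * r) (by linarith)).1
          (h.lt_top x₀ h.center (2 * r) (by linarith) (by nlinarith)).1.ne)
        (fun x hx ρ hρ hρr => hT x hx ρ hρ hρr l k hlk)
    refine (meas_trunc_eq_le h hp hpq hft hK hκ'
      (tendsto_average_trunc h hp hpq hK hf hκ hu hL hlk) ht hee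
      ((enorm_average_trunc_sub_le hlk hclamp (hu x₀ r hr) hμ0 hμt).trans hhalf)).trans ?_
    gcongr
  -- Two truncations, above and below c, each with its near endpoint as e and its far endpoint as
  -- e'; they account for the factor 2 in the bound.
  have h1 := main (c + t) (c + 2 * t) (c + t) (c + 2 * t) (by linarith)
    (fun a => abs_clamp_sub_left_le (by linarith))
    (fun a ha ha' => by rw [abs_of_pos (by linarith)]; constructor <;> linarith)
    (by rw [show c + 2 * t - (c + t) = t by ring, abs_of_pos ht])
  have h2 := main (c - 2 * t) (c - t) (c - t) (c - 2 * t) (by linarith)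
    (fun a => abs_clamp_sub_right_le (by linarith) (by linarith))
    (fun a ha ha' => by rw [abs_of_neg (by linarith)]; constructor <;> linarith)
    (by rw [show c - 2 * t - (c - t) = -t by ring, abs_neg, abs_of_pos ht])
  rw [two_mul (weakConst D θ p q * _ / _)]
  refine le_trans (measure_mono ?_) ((measure_union_le _ _).trans (add_le_add h1 h2))
  rintro x ⟨hxS, hx⟩
  rcases trunc_of_two_mul_le_abs ht hx with hh | hh
  · exact Or.inl ⟨hxS, hh⟩
  · exact Or.inr ⟨hxS, hh⟩

/-- The gradients on the dyadic level sets add up to at most the full gradient. -/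
lemma tsum_gradMeasure_level_le (hp : 0 < p) {R c : ℝ}
    (hu : AEMeasurable u (μ.restrict (ball x₀ R)))
    (hg : AEMeasurable g (μ.restrict (ball x₀ R))) :
    ∑' j : ℤ, gradMeasure μ p ((levelSet u c ((2 : ℝ) ^ j)).indicator g) (ball x₀ R) ≤
      gradMeasure μ p g (ball x₀ R) := by
  simp_rw [gradMeasure_ball]
  have hmeas : ∀ j : ℤ, NullMeasurableSet (levelSet u c ((2 : ℝ) ^ j)) (μ.restrict (ball x₀ R)) :=
    fun j => by
      have hF := (measurable_abs_sub c).comp_aemeasurable hu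
      exact (hF.nullMeasurableSet_preimage measurableSet_Ioi).inter
        (hF.nullMeasurableSet_preimage measurableSet_Iio)
  rw [← lintegral_tsum fun j => (hg.indicator₀ (hmeas j)).pow_const p]
  refine lintegral_mono fun y => ?_
  by_cases hy : ∃ j : ℤ, y ∈ levelSet u c ((2 : ℝ) ^ j)
  · obtain ⟨j, hj⟩ := hy
    rw [tsum_eq_single j]
    · exact ENNReal.rpow_le_rpow (indicator_le_self _ _ y) hp.le
    · intro i hij
      rw [indicator_of_notMem, ENNReal.zero_rpow_of_pos hp]
      intro hi
      refine hij ?_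
      -- Disjointness: 2^i < |u - c| < 2^(j+1) forces i ≤ j, and symmetrically.
      have key : ∀ i j : ℤ, y ∈ levelSet u c ((2 : ℝ) ^ i) → y ∈ levelSet u c ((2 : ℝ) ^ j) →
          i ≤ j := fun i j hi hj => by
        have h1 := hi.1.trans hj.2
        rw [ENNReal.ofReal_lt_ofReal_iff_of_nonneg (by positivity), ← zpow_one_add₀ two_ne_zero,
          zpow_lt_zpow_iff_right₀ one_lt_two] at h1
        omega
      exact le_antisymm (key i j hi hj) (key j i hj hi)
  · push Not at hy
    simp [indicator_of_notMem (hy _), ENNReal.zero_rpow_of_pos hp]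

end

end TwoWeight

/-! ### The strong estimate at the exponent q -/

namespace TwoWeight

open scoped Classical in
/-- Dyadic bound of a power by the levels above `m`. -/
lemma rpow_le_add_tsum_level {F m : ℝ≥0∞} (hF : F < ∞) {q : ℝ} (hq : 0 < q) :
    F ^ q ≤ (8 * m) ^ q + ∑' j : ℤ, if 2 * m < ENNReal.ofReal ((2 : ℝ) ^ j) ∧
      ENNReal.ofReal (2 * (2 : ℝ) ^ j) ≤ F then ENNReal.ofReal (4 * (2 : ℝ) ^ j) ^ q else 0 := by
  rcases eq_or_ne F 0 with h0 | h0
  · simp [h0, ENNReal.zero_rpow_of_pos hq]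
  -- With 2^n ≤ F < 2^(n+1), the index j = n - 1 gives 2·2^j ≤ F ≤ 4·2^j. If this level is not above
  -- 2m, then F ≤ 4·2m, the origin of 8m.
  obtain ⟨n, hn1, hn2⟩ := exists_mem_Ico_zpow (ENNReal.toReal_pos h0 hF.ne) one_lt_two
  have e1 : 2 * (2 : ℝ) ^ (n - 1) = 2 ^ n := by
    rw [← zpow_one_add₀ two_ne_zero]; congr 1; ring
  have e2 : 4 * (2 : ℝ) ^ (n - 1) = 2 ^ (n + 1) := by
    rw [zpow_add_one₀ two_ne_zero, ← e1]; ring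
  have h1 : ENNReal.ofReal (2 * (2 : ℝ) ^ (n - 1)) ≤ F := by
    rw [e1]; exact ENNReal.ofReal_le_of_le_toReal hn1
  have h2 : F ≤ ENNReal.ofReal (4 * (2 : ℝ) ^ (n - 1)) := by
    rw [e2, ENNReal.le_ofReal_iff_toReal_le hF.ne (by positivity)]
    exact hn2.le
  by_cases hm : 2 * m < ENNReal.ofReal ((2 : ℝ) ^ (n - 1))
  · refine le_add_of_nonneg_of_le zero_le ?_
    refine le_trans ?_ (ENNReal.le_tsum (n - 1))
    rw [if_pos ⟨hm, h1⟩]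
    exact ENNReal.rpow_le_rpow h2 hq.le
  · refine le_add_of_le_of_nonneg (ENNReal.rpow_le_rpow ?_ hq.le) zero_le
    calc F ≤ ENNReal.ofReal (4 * (2 : ℝ) ^ (n - 1)) := h2
      _ = 4 * ENNReal.ofReal ((2 : ℝ) ^ (n - 1)) := by
        rw [ENNReal.ofReal_mul (by norm_num), ENNReal.ofReal_ofNat]
      _ ≤ 4 * (2 * m) := by gcongr; exact not_lt.1 hm
      _ = 8 * m := by ring

/-- The constant in the strong type estimate. -/
noncomputable def strongConst (D θ : ℝ≥0∞) (p q : ℝ) : ℝ≥0∞ :=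
  8 ^ q + 2 * weakConst D θ p q * 16 ^ q

lemma strongConst_ne_top {D θ : ℝ≥0∞} {p q : ℝ} (hD : D ≠ ∞) (hθ : θ < 1) (hp : 0 < p)
    (hpq : p < q) : strongConst D θ p q ≠ ∞ := by
  have hq := (hp.trans hpq).le
  exact ENNReal.add_ne_top.2 ⟨ENNReal.rpow_ne_top_of_nonneg hq (by simp),
    ENNReal.mul_ne_top (ENNReal.mul_ne_top (by simp) (weakConst_ne_top hD hθ hp hpq))
      (ENNReal.rpow_ne_top_of_nonneg hq (by simp))⟩

section

variable {X : Type*} [MetricSpace X] [MeasurableSpace X] [OpensMeasurableSpace X]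
  {μ ν : Measure X}
  {E : Set X} {x₀ : X} {r lam : ℝ} {D θ : ℝ≥0∞} {p q α CP : ℝ} {u : X → EReal} {g : X → ℝ≥0∞}

/-- The strong type estimate at the exponent `q`, by truncation. -/
lemma oscNorm_le_of_truncPoincare (h : LocalDoubling μ ν E x₀ r lam D θ)
    (hp : 0 < p) (hpq : p < q) (hα : 0 < α) (hCP : 0 < CP)
    (hΘ : Theta μ ν (E ∩ ball x₀ r) p q α lam r ≠ ∞)
    (hP : ∀ x ∈ E, ∀ ρ : ℝ, 0 < ρ → ρ ≤ 2 * r → PoincareAt μ p α lam CP u g x ρ)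
    (hT : ∀ x ∈ E, ∀ ρ : ℝ, 0 < ρ → ρ ≤ 2 * r → TruncPoincareAt μ p α lam CP u g x ρ)
    (hκ : gradMeasure μ p g (ball x₀ (2 * lam * r)) ≠ ∞)
    (hE : NullMeasurableSet E ν) (hu : MemL1Loc μ u) (hg : MemLpLoc μ p g)
    (hL : LebesguePoints μ ν E u) :
    oscNorm μ ν E q u x₀ r ≤ strongConst D θ p q ^ (1 / q) *
      (ENNReal.ofReal (CP * 4 ^ α) * Theta μ ν (E ∩ ball x₀ r) p q α lam r) *
      gradNorm μ p g x₀ (2 * lam * r) := by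
  classical
  set c := ballAvg μ u x₀ r with hc
  set K := ENNReal.ofReal (CP * 4 ^ α) * Theta μ ν (E ∩ ball x₀ r) p q α lam r with hKdef
  set m := ⨍⁻ y in ball x₀ r, ‖(u y).toReal - c‖ₑ ∂μ with hm
  set k := gradMeasure μ p g (ball x₀ (2 * lam * r)) with hk
  have hK : K ≠ ∞ := ENNReal.mul_ne_top ENNReal.ofReal_ne_top hΘ
  have hr := h.r_pos
  have hlam := h.one_le_lam
  have hq : 0 < q := hp.trans hpq
  have hR : 0 < 2 * lam * r := by positivity
  have hf := OscBound.of_poincare (q := q) h hp hα hCP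
    (fun x _ ρ hρ _ => (hu x ρ hρ).integrableOn_toReal)
    (hu x₀ (2 * r) (by linarith)).integrableOn_toReal hP
  have hn0 := (h.pos x₀ h.center r hr).2.ne'
  have hnt := (h.lt_top x₀ h.center r hr (h.radius_le le_rfl)).2.ne
  have hW : weakConst D θ p q * (K ^ q * k ^ (q / p)) ≠ ∞ :=
    ENNReal.mul_ne_top (weakConst_ne_top h.D_ne_top h.θ_lt_one hp hpq)
      (ENNReal.mul_ne_top (ENNReal.rpow_ne_top_of_nonneg hq.le hK)
        (ENNReal.rpow_ne_top_of_nonneg (by positivity) hκ))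
  have hmeas := aemeasurable_of_lebesguePoints hu hL hE hr (x₀ := x₀)
  have hFmeas := (measurable_abs_sub c).comp_aemeasurable hmeas
  have hS : NullMeasurableSet (ball x₀ r ∩ E) ν := measurableSet_ball.nullMeasurableSet.inter hE
  -- The dyadic decomposition needs finite values; the weak estimate provides them almost
  -- everywhere.
  have hfin : ∀ᵐ x ∂ν.restrict (ball x₀ r ∩ E), (u x - (c : EReal)).abs < ∞ :=
    ae_lt_top_of_weak hq hW fun t ht ht' => by
      rw [Measure.restrict_apply₀' hS]
      refine (measure_mono fun x hx => ?_).trans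
        (meas_abs_sub_gt_le h hp hpq hf hK hκ (hL.tendsto_dyadic hr) ht ht')
      exact ⟨hx.2, hx.1⟩
  -- Levels comparable to the mean oscillation m are outside the reach of the truncation argument;
  -- there the oscillation bound for m on B itself, raised to the power q, cancels ν(B).
  have hmν : (8 * m) ^ q * ν (ball x₀ r ∩ E) ≤ 8 ^ q * (K ^ q * k ^ (q / p)) := by
    have h1 : m ≤ K * (ν (ball x₀ r) ^ (-(1 / q)) * k ^ (1 / p)) := by
      refine (hf.small x₀ h.center r hr le_rfl).trans ?_
      gcongr
      exact measure_mono (h.ball_subset h.center le_rfl)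
    clear_value K
    calc (8 * m) ^ q * ν (ball x₀ r ∩ E)
        ≤ (8 * (K * (ν (ball x₀ r) ^ (-(1 / q)) * k ^ (1 / p)))) ^ q * ν (ball x₀ r) := by
          gcongr
          exact inter_subset_left
      _ = 8 ^ q * (K ^ q * k ^ (q / p)) * ((ν (ball x₀ r))⁻¹ * ν (ball x₀ r)) := by
          rw [ENNReal.mul_rpow_of_nonneg _ _ hq.le, ENNReal.mul_rpow_of_nonneg K _ hq.le,
            ENNReal.mul_rpow_of_nonneg _ _ hq.le, ← ENNReal.rpow_mul, ← ENNReal.rpow_mul,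
            neg_mul, one_div_mul_cancel hq.ne', ENNReal.rpow_neg_one,
            show 1 / p * q = q / p by ring]
          ring
      _ = _ := by rw [ENNReal.inv_mul_cancel hn0 hnt, mul_one]
  set κ : ℤ → ℝ≥0∞ := fun j => gradMeasure μ p ((levelSet u c ((2 : ℝ) ^ j)).indicator g)
    (ball x₀ (2 * lam * r)) with hκdef
  have hlevel : ∀ j : ℤ, ∫⁻ x in ball x₀ r ∩ E, (if 2 * m < ENNReal.ofReal ((2 : ℝ) ^ j) ∧
      ENNReal.ofReal (2 * (2 : ℝ) ^ j) ≤ (u x - (c : EReal)).abs then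
        ENNReal.ofReal (4 * (2 : ℝ) ^ j) ^ q else 0) ∂ν ≤
      2 * weakConst D θ p q * 16 ^ q * (K ^ q * κ j ^ (q / p)) := by
    intro j
    by_cases hj : 2 * m < ENNReal.ofReal ((2 : ℝ) ^ j)
    · have ht : (0 : ℝ) < 2 ^ j := by positivity
      set A := {x | ENNReal.ofReal (2 * (2 : ℝ) ^ j) ≤ (u x - (c : EReal)).abs} with hA
      have e : ∀ x, (if 2 * m < ENNReal.ofReal ((2 : ℝ) ^ j) ∧
          ENNReal.ofReal (2 * (2 : ℝ) ^ j) ≤ (u x - (c : EReal)).abs then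
            ENNReal.ofReal (4 * (2 : ℝ) ^ j) ^ q else 0) =
          A.indicator (fun _ => ENNReal.ofReal (4 * (2 : ℝ) ^ j) ^ q) x := fun x => by
        simp only [hj, true_and, indicator_apply, hA, mem_ofPred_eq]
      simp_rw [e]
      refine (lintegral_indicator_const_le _ _).trans ?_
      rw [Measure.restrict_apply₀' hS]
      have h1 := meas_level_le h hp hpq hα hCP hΘ hP hT hκ hu hL ht hj
      have h2 : ν (A ∩ (ball x₀ r ∩ E)) ≤ 2 * (weakConst D θ p q * (K ^ q * κ j ^ (q / p)) /
          ENNReal.ofReal ((2 : ℝ) ^ j / 4) ^ q) := by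
        rw [inter_comm]
        exact h1
      refine (mul_le_mul_right h2 _).trans (le_of_eq ?_)
      -- The size 4·2^j of F on this level against the threshold 2^j/4 of the weak estimate: the
      -- origin of 16^q in `strongConst`.
      have e2 : ENNReal.ofReal (4 * (2 : ℝ) ^ j) = 16 * ENNReal.ofReal ((2 : ℝ) ^ j / 4) := by
        rw [← ENNReal.ofReal_ofNat 16, ← ENNReal.ofReal_mul (by norm_num)]
        congr 1; ring
      have hs0 : ENNReal.ofReal ((2 : ℝ) ^ j / 4) ^ q ≠ 0 := by
        rw [ENNReal.ofReal_rpow_of_pos (by positivity)]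
        simpa using Real.rpow_pos_of_pos (by positivity) q
      have hst : ENNReal.ofReal ((2 : ℝ) ^ j / 4) ^ q ≠ ∞ :=
        ENNReal.rpow_ne_top_of_nonneg hq.le ENNReal.ofReal_ne_top
      rw [e2, ENNReal.mul_rpow_of_nonneg 16 _ hq.le, ENNReal.div_eq_inv_mul]
      calc _ = 2 * weakConst D θ p q * 16 ^ q * (K ^ q * κ j ^ (q / p)) *
            (ENNReal.ofReal ((2 : ℝ) ^ j / 4) ^ q * (ENNReal.ofReal ((2 : ℝ) ^ j / 4) ^ q)⁻¹) := by
            ring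
        _ = _ := by rw [ENNReal.mul_inv_cancel hs0 hst, mul_one]
    · simp [hj]
  have hmeasj : ∀ j : ℤ, AEMeasurable (fun x => if 2 * m < ENNReal.ofReal ((2 : ℝ) ^ j) ∧
      ENNReal.ofReal (2 * (2 : ℝ) ^ j) ≤ (u x - (c : EReal)).abs then
        ENNReal.ofReal (4 * (2 : ℝ) ^ j) ^ q else 0) (ν.restrict (ball x₀ r ∩ E)) := fun j => by
    have hG : Measurable fun y : ℝ≥0∞ => if 2 * m < ENNReal.ofReal ((2 : ℝ) ^ j) ∧
      ENNReal.ofReal (2 * (2 : ℝ) ^ j) ≤ y then ENNReal.ofReal (4 * (2 : ℝ) ^ j) ^ q else 0 :=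
      Measurable.ite ((MeasurableSet.const _).inter measurableSet_Ici) measurable_const
        measurable_const
    exact hG.comp_aemeasurable hFmeas
  have hsum : ∑' j, κ j ^ (q / p) ≤ k ^ (q / p) :=
    (tsum_rpow_le_rpow_tsum κ ((one_le_div hp).2 hpq.le)).trans
      (ENNReal.rpow_le_rpow (tsum_gradMeasure_level_le hp (hu x₀ _ hR).1 (hg x₀ _ hR).1)
        (by positivity))
  have hmain : ∫⁻ x in ball x₀ r ∩ E, (u x - (c : EReal)).abs ^ q ∂ν ≤
      strongConst D θ p q * (K ^ q * k ^ (q / p)) := by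
    calc ∫⁻ x in ball x₀ r ∩ E, (u x - (c : EReal)).abs ^ q ∂ν
        ≤ ∫⁻ x in ball x₀ r ∩ E, ((8 * m) ^ q + ∑' j : ℤ,
          if 2 * m < ENNReal.ofReal ((2 : ℝ) ^ j) ∧
            ENNReal.ofReal (2 * (2 : ℝ) ^ j) ≤ (u x - (c : EReal)).abs then
              ENNReal.ofReal (4 * (2 : ℝ) ^ j) ^ q else 0) ∂ν := by
          refine lintegral_mono_ae ?_
          filter_upwards [hfin] with x hx
          exact rpow_le_add_tsum_level hx hq
      _ ≤ 8 ^ q * (K ^ q * k ^ (q / p)) +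
          ∑' j, 2 * weakConst D θ p q * 16 ^ q * (K ^ q * κ j ^ (q / p)) := by
          rw [lintegral_add_left measurable_const, setLIntegral_const, lintegral_tsum hmeasj]
          exact add_le_add hmν (ENNReal.tsum_le_tsum hlevel)
      _ ≤ 8 ^ q * (K ^ q * k ^ (q / p)) +
          2 * weakConst D θ p q * 16 ^ q * (K ^ q * k ^ (q / p)) := by
          rw [ENNReal.tsum_mul_left, ENNReal.tsum_mul_left]
          gcongr
      _ = _ := by rw [strongConst]; ring
  refine (ENNReal.rpow_le_rpow hmain (by positivity)).trans (le_of_eq ?_)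
  rw [gradNorm_eq, ENNReal.mul_rpow_of_nonneg _ _ (by positivity),
    ENNReal.mul_rpow_of_nonneg (K ^ q) _ (by positivity), ← ENNReal.rpow_mul, ← ENNReal.rpow_mul,
    mul_one_div_cancel hq.ne', ENNReal.rpow_one, show q / p * (1 / q) = 1 / p by field_simp]
  ring

end

end TwoWeight

/-! ### Doubling, decay and reverse doubling -/

namespace TwoWeight

section

variable {X : Type*} [MetricSpace X] [MeasurableSpace X] {μ ν : Measure X} {C : ℝ} {x : X}
  {r₀ : ℝ}

lemma DoublingAt.lt_top {r : ℝ} (hC : 0 < C) (h : DoublingAt μ C x r) : μ (ball x r) < ∞ := by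
  refine lt_top_iff_ne_top.2 fun hh => ?_
  have h1 := h.2.2
  rw [hh, ENNReal.mul_top (by simpa using hC)] at h1
  exact lt_irrefl _ h1

lemma DoublingAt.pos {r : ℝ} (h : DoublingAt μ C x r) : 0 < μ (ball x r) := by
  refine pos_iff_ne_zero.2 fun hh => ?_
  have h1 := h.1.trans_le h.2.1
  simp [hh] at h1

lemma measure_ball_pos_of_doubling (hr₀ : 0 < r₀)
    (h : ∀ r : ℝ, 0 < r → r ≤ r₀ → DoublingAt μ C x r) {ρ : ℝ} (hρ : 0 < ρ) :
    0 < μ (ball x ρ) :=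
  (h (min ρ r₀) (lt_min hρ hr₀) (min_le_right _ _)).pos.trans_le
    (measure_mono (ball_subset_ball (min_le_left _ _)))

lemma measure_ball_two_pow_le (h : ∀ r : ℝ, 0 < r → r ≤ r₀ → DoublingAt μ C x r) (n : ℕ)
    {ρ : ℝ} (hρ : 0 < ρ) (hn : 2 ^ n * ρ ≤ 2 * r₀) :
    μ (ball x (2 ^ n * ρ)) ≤ ENNReal.ofReal C ^ n * μ (ball x ρ) := by
  induction n with
  | zero => simp
  | succ n ih =>
    have hpos : 0 < 2 ^ n * ρ := by positivity
    rw [pow_succ, mul_comm _ (2 : ℝ), mul_assoc] at hn ⊢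
    calc μ (ball x (2 * (2 ^ n * ρ))) ≤ ENNReal.ofReal C * μ (ball x (2 ^ n * ρ)) :=
          (h _ hpos (by linarith)).2.1
      _ ≤ ENNReal.ofReal C * (ENNReal.ofReal C ^ n * μ (ball x ρ)) := by
          gcongr
          exact ih (by linarith)
      _ = _ := by ring

/-- Doubling for balls centred in `E` and geometric decay give the local doubling structure. -/
lemma LocalDoubling.of_doubling {E : Set X} {x₀ : X} {r lam Cμ Cν : ℝ} {D θ : ℝ≥0∞} {N : ℕ}
    (hCμ : 0 < Cμ) (hCν : 0 < Cν) (hr : 0 < r) (hlam : 1 ≤ lam) (hrr : 10 * lam * r ≤ r₀)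
    (hN : 3 * lam ≤ 2 ^ N) (hN' : (2 : ℝ) ^ N ≤ 6 * lam)
    (hDt : D ≠ ∞) (hD1 : 1 ≤ D) (hDμ : ENNReal.ofReal Cμ ≤ D) (hDμ2 : ENNReal.ofReal Cμ ^ 2 ≤ D)
    (hDν : ENNReal.ofReal Cν ^ N ≤ D) (hθ : θ < 1) (hx₀ : x₀ ∈ E)
    (h : ∀ x ∈ E, ∀ r : ℝ, 0 < r → r ≤ r₀ → DoublingAt μ Cμ x r ∧ DoublingAt ν Cν x r)
    (hdecay : ∀ x ∈ E, ∀ i j : ℕ,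
      ν (ball x (r / 2 ^ (i + j))) ≤ D * θ ^ j * ν (ball x (r / 2 ^ i))) :
    LocalDoubling μ ν E x₀ r lam D θ := by
  have hlr : r ≤ lam * r := le_mul_of_one_le_left hr.le hlam
  have hr₀ : 0 < r₀ := by linarith
  have hμ := fun x hx r hr hrr => (h x hx r hr hrr).1
  have hν := fun x hx r hr hrr => (h x hx r hr hrr).2
  refine ⟨hr, hlam, hDt, hD1, hθ, hx₀, fun x hx ρ hρ => ?_, fun x hx ρ hρ hρr => ?_,
    fun x hx ρ hρ hρr => ?_, fun x hx => ?_, fun x hx ρ hρ hρr => ?_,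
    fun x hx => hdecay x hx.2⟩
  · exact ⟨measure_ball_pos_of_doubling hr₀ (hμ x hx.2) hρ,
      measure_ball_pos_of_doubling hr₀ (hν x hx.2) hρ⟩
  · have := h x hx.2 ρ hρ (by linarith)
    exact ⟨this.1.lt_top hCμ, this.2.lt_top hCν⟩
  · have := (hμ x hx.2 (ρ / 2) (by linarith) (by linarith)).2.1
    rw [mul_div_cancel₀ ρ two_ne_zero] at this
    exact this.trans (by gcongr)
  · calc μ (ball x₀ (2 * r)) ≤ μ (ball x (2 ^ 2 * r)) :=
          measure_mono (ball_subset_ball' (by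
            have := mem_ball.1 hx.1; rw [dist_comm] at this; linarith))
      _ ≤ ENNReal.ofReal Cμ ^ 2 * μ (ball x r) :=
          measure_ball_two_pow_le (hμ x hx.2) 2 hr (by linarith)
      _ ≤ _ := by gcongr
  · have h1 : 3 * lam * ρ ≤ 2 ^ N * ρ := by gcongr
    -- The upper bound 2^N ≤ 6λ keeps every radius to which doubling is applied below r₀; the
    -- assumption 10λr ≤ r₀ leaves ample room.
    have h2 : 2 ^ N * ρ ≤ 2 * r₀ := by
      calc 2 ^ N * ρ ≤ 6 * lam * r := by gcongr
        _ ≤ _ := by linarith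
    calc ν (ball x (3 * lam * ρ)) ≤ ν (ball x (2 ^ N * ρ)) := measure_mono (ball_subset_ball h1)
      _ ≤ ENNReal.ofReal Cν ^ N * ν (ball x ρ) :=
          measure_ball_two_pow_le (hν x hx.2) N hρ h2
      _ ≤ _ := by gcongr

lemma exists_two_pow_enlargement {lam : ℝ} (hlam : 1 ≤ lam) :
    ∃ N : ℕ, 3 * lam ≤ 2 ^ N ∧ (2 : ℝ) ^ N ≤ 6 * lam := by
  obtain ⟨n, h1, h2⟩ := exists_nat_pow_near (x := 3 * lam) (y := 2) (by linarith) one_lt_two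
  exact ⟨n + 1, h2.le, by rw [pow_succ]; linarith⟩

/-- Dyadic form of the decay condition. -/
lemma dyadic_decay_of_decay {r Cν Cδ δ : ℝ} (hCν : 0 < Cν) (hCδ : 0 < Cδ) {D : ℝ≥0∞}
    (hr : 0 < r) (hrr : r ≤ r₀) (hD1 : 1 ≤ D) (hD : ENNReal.ofReal Cδ ≤ D)
    (h : ∀ r : ℝ, 0 < r → r ≤ r₀ → DoublingAt ν Cν x r)
    (hdecay : ∀ r' r : ℝ, 0 < r' → r' < r → r ≤ r₀ →
      ν (ball x r') / ν (ball x r) ≤ ENNReal.ofReal (Cδ * (r' / r) ^ δ)) (i j : ℕ) :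
    ν (ball x (r / 2 ^ (i + j))) ≤
      D * ENNReal.ofReal (2 ^ (-δ)) ^ j * ν (ball x (r / 2 ^ i)) := by
  rcases Nat.eq_zero_or_pos j with rfl | hj
  -- The decay condition is stated for r' < r only, so j = 0 rests on 1 ≤ D.
  · simpa using le_mul_of_one_le_left zero_le hD1
  have hi : r / 2 ^ i ≤ r₀ := (div_two_pow_le hr i).trans hrr
  have hi0 : 0 < r / 2 ^ i := by positivity
  have hd := h _ hi0 hi
  have hlt : r / 2 ^ (i + j) < r / 2 ^ i :=
    div_lt_div_of_pos_left hr (by positivity)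
      (pow_lt_pow_right₀ one_lt_two (by omega))
  have h1 := hdecay _ _ (by positivity) hlt hi
  rw [ENNReal.div_le_iff hd.pos.ne' (hd.lt_top hCν).ne] at h1
  refine h1.trans ?_
  have e : r / 2 ^ (i + j) / (r / 2 ^ i) = (2 : ℝ) ^ (-(j : ℝ)) := by
    rw [Real.rpow_neg two_pos.le, Real.rpow_natCast, pow_add]
    field_simp
  rw [e, ← Real.rpow_mul two_pos.le, ENNReal.ofReal_mul hCδ.le,
    ← ENNReal.ofReal_pow (by positivity), ← Real.rpow_natCast (2 ^ (-δ)) j,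
    ← Real.rpow_mul two_pos.le, show -(j : ℝ) * δ = -δ * j by ring]
  gcongr

/-- Uniform perfectness and doubling give reverse doubling. -/
lemma reverse_doubling_of_uniformlyPerfect [OpensMeasurableSpace X] {E : Set X} {a Cν : ℝ}
    {m n : ℕ} (ha : 0 < a)
    (ha1 : a < 1) (hCν : 0 < Cν) (hE : UniformlyPerfect E a)
    (h : ∀ x ∈ E, ∀ r : ℝ, 0 < r → DoublingAt ν Cν x r) (hm : 8 ≤ 2 ^ m * a)
    (hn : 4 ≤ 2 ^ n * a) (hx : x ∈ E) {ρ : ℝ} (hρ : 0 < ρ) :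
    ν (ball x (ρ / 2 ^ n)) ≤ (1 - (2 * (1 + ENNReal.ofReal Cν) ^ m)⁻¹) * ν (ball x ρ) := by
  -- The point y of E satisfies aρ/2 ≤ d(x, y) < ρ/2, so the balls of radius aρ/4 at x and y are
  -- disjoint and lie in B(x, ρ). The choice of m makes 2^m aρ/4 ≥ 2ρ, so B(x, ρ) is reached from
  -- the ball at y by m doublings; that of n makes ρ/2^n ≤ aρ/4.
  obtain ⟨y, ⟨hyE, hy1⟩, hy2⟩ := hE x hx (ρ / 2) (by linarith)
  rw [mem_ball] at hy1 hy2
  rw [not_lt] at hy2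
  set G : ℝ≥0∞ := 2 * (1 + ENNReal.ofReal Cν) ^ m with hG
  have hG1 : 1 ≤ G := by
    have : (1 : ℝ≥0∞) ≤ (1 + ENNReal.ofReal Cν) ^ m := one_le_pow₀ le_self_add
    calc (1 : ℝ≥0∞) ≤ 2 * 1 := by norm_num
      _ ≤ G := by rw [hG]; gcongr
  have hGt : G ≠ ∞ := ENNReal.mul_ne_top (by simp) (ENNReal.pow_ne_top (by simp))
  have hG0 : G ≠ 0 := (zero_lt_one.trans_le hG1).ne'
  have hT : ν (ball x ρ) ≠ ∞ := ((h x hx ρ hρ).lt_top hCν).ne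
  have haρ : 0 < a * ρ := by positivity
  have haρ' : a * ρ < ρ := by nlinarith
  have hsmall : ρ / 2 ^ n ≤ a * ρ / 4 := by
    rw [div_le_div_iff₀ (by positivity) (by norm_num)]
    nlinarith
  have hdisj : Disjoint (ball x (a * ρ / 4)) (ball y (a * ρ / 4)) :=
    ball_disjoint_ball (by rw [dist_comm]; linarith)
  have hsum : ν (ball x (ρ / 2 ^ n)) + ν (ball y (a * ρ / 4)) ≤ ν (ball x ρ) := by
    calc _ ≤ ν (ball x (a * ρ / 4)) + ν (ball y (a * ρ / 4)) := by gcongr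
      _ = ν (ball x (a * ρ / 4) ∪ ball y (a * ρ / 4)) :=
          (measure_union hdisj measurableSet_ball).symm
      _ ≤ _ := measure_mono (union_subset (ball_subset_ball (by linarith))
          (ball_subset_ball' (by linarith)))
  have hbig : ν (ball x ρ) ≤ G * ν (ball y (a * ρ / 4)) := by
    calc ν (ball x ρ) ≤ ν (ball y (2 ^ m * (a * ρ / 4))) := by
          refine measure_mono (ball_subset_ball' ?_)
          rw [dist_comm]
          nlinarith
      _ ≤ ENNReal.ofReal Cν ^ m * ν (ball y (a * ρ / 4)) :=
          measure_ball_two_pow_le (r₀ := 2 ^ m * (a * ρ / 4)) (fun r hr _ => h y hyE r hr) m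
            (by linarith) (by have : 0 < 2 ^ m * (a * ρ / 4) := by positivity
                              linarith)
      _ ≤ G * ν (ball y (a * ρ / 4)) := by
          gcongr
          calc ENNReal.ofReal Cν ^ m ≤ (1 + ENNReal.ofReal Cν) ^ m := by gcongr; exact le_add_self
            _ ≤ G := le_mul_of_one_le_left zero_le (by norm_num)
  have hY : G⁻¹ * ν (ball x ρ) ≤ ν (ball y (a * ρ / 4)) := by
    rw [← ENNReal.div_eq_inv_mul]
    exact ENNReal.div_le_of_le_mul' hbig
  have hfin : G⁻¹ * ν (ball x ρ) ≠ ∞ := ENNReal.mul_ne_top (ENNReal.inv_ne_top.2 hG0) hT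
  rw [← ENNReal.add_le_add_iff_right hfin, ← add_mul,
    tsub_add_cancel_of_le (ENNReal.inv_le_one.2 hG1), one_mul]
  exact (add_le_add_right hY _).trans hsum

/-- Reverse doubling acts once every n dyadic steps, so it is iterated ⌊j/n⌋ times; since ⌊j/n⌋ ≥
j/n - 1, rounding costs at most the factor γ⁻¹. -/
lemma dyadic_decay_of_reverse_doubling {γ : ℝ≥0∞} {n : ℕ} (hn : 0 < n) (hγ0 : γ ≠ 0)
    (hγ1 : γ ≤ 1) (h : ∀ ρ : ℝ, 0 < ρ → ν (ball x (ρ / 2 ^ n)) ≤ γ * ν (ball x ρ))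
    {r : ℝ} (hr : 0 < r) (i j : ℕ) :
    ν (ball x (r / 2 ^ (i + j))) ≤ γ⁻¹ * (γ ^ (1 / (n : ℝ))) ^ j * ν (ball x (r / 2 ^ i)) := by
  have hiter : ∀ k : ℕ, ν (ball x (r / 2 ^ (i + n * k))) ≤ γ ^ k * ν (ball x (r / 2 ^ i)) := by
    intro k
    induction k with
    | zero => simp
    | succ k ih =>
      have e : r / 2 ^ (i + n * (k + 1)) = r / 2 ^ (i + n * k) / 2 ^ n := by
        rw [div_div, ← pow_add]; congr 2; ring
      rw [e]
      refine (h _ (by positivity)).trans ?_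
      rw [pow_succ', mul_assoc]
      gcongr
  have hγt : γ ≠ ∞ := ne_top_of_le_ne_top (by simp) hγ1
  have hk : n * (j / n) ≤ j := Nat.mul_div_le j n
  have hk' : (j : ℝ) / n - 1 ≤ ((j / n : ℕ) : ℝ) := by
    have : j < n * (j / n) + n := by
      have := Nat.lt_mul_div_succ j hn
      rwa [Nat.mul_add, mul_one] at this
    have hn' : (0 : ℝ) < n := by exact_mod_cast hn
    rw [sub_le_iff_le_add, div_le_iff₀ hn']
    have : (j : ℝ) < n * ((j / n : ℕ) : ℝ) + n := by exact_mod_cast this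
    linarith
  calc ν (ball x (r / 2 ^ (i + j))) ≤ ν (ball x (r / 2 ^ (i + n * (j / n)))) := by
        refine measure_mono (ball_subset_ball ?_)
        gcongr
        exact one_le_two
    _ ≤ γ ^ (j / n) * ν (ball x (r / 2 ^ i)) := hiter _
    _ ≤ γ⁻¹ * (γ ^ (1 / (n : ℝ))) ^ j * ν (ball x (r / 2 ^ i)) := by
        gcongr
        rw [← ENNReal.rpow_natCast (γ ^ (1 / (n : ℝ))), ← ENNReal.rpow_mul,
          ← ENNReal.rpow_neg_one, ← ENNReal.rpow_add _ _ hγ0 hγt, ← ENNReal.rpow_natCast]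
        refine ENNReal.rpow_le_rpow_of_exponent_ge hγ1 (le_of_eq_of_le ?_ hk')
        ring

end

lemma oscNorm_eq_zero_of_measure_zero {X : Type*} [MetricSpace X] [MeasurableSpace X]
    {μ ν : Measure X} {E : Set X} {x₀ : X} {r : ℝ} {u : X → EReal} {s : ℝ} (hs : 0 < s) (h : ν (ball x₀ r ∩ E) = 0) :
    oscNorm μ ν E s u x₀ r = 0 := by
  rw [oscNorm, Measure.restrict_eq_zero.2 h]
  simp [hs]

section

variable {X : Type*} [MetricSpace X] [MeasurableSpace X] [OpensMeasurableSpace X]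
  {μ ν : Measure X}
  {E : Set X} {x₀ : X} {r lam : ℝ} {D θ : ℝ≥0∞} {p q : ℝ} {u : X → EReal} {g : X → ℝ≥0∞}

/-- With K = 0 the weak estimate says that every superlevel set is null. This serves the convention
0·∞ = 0, when the gradient vanishes but Θ may be infinite. -/
lemma oscNorm_eq_zero_of_oscBound_zero (h : LocalDoubling μ ν E x₀ r lam D θ)
    (hp : 0 < p) (hpq : p < q) {s : ℝ} (hs : 0 < s)
    (hf : OscBound μ ν (gradMeasure μ p g) E x₀ r lam p q 0 (fun y => (u y).toReal))
    (hκ : gradMeasure μ p g (ball x₀ (2 * lam * r)) ≠ ∞)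
    (hE : NullMeasurableSet E ν) (hL : LebesguePoints μ ν E u) :
    oscNorm μ ν E s u x₀ r = 0 := by
  have hS : NullMeasurableSet (ball x₀ r ∩ E) ν := measurableSet_ball.nullMeasurableSet.inter hE
  have h0 : ∀ᵐ x ∂ν.restrict (ball x₀ r ∩ E), (u x - (ballAvg μ u x₀ r : EReal)).abs = 0 :=
    ae_eq_zero_of_weak fun t ht ht' => by
      rw [Measure.restrict_apply₀' hS, ← nonpos_iff_eq_zero]
      refine (measure_mono fun x hx => ?_).trans ((meas_abs_sub_gt_le h hp hpq hf (by simp) hκ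
        (hL.tendsto_dyadic h.r_pos) ht ht').trans (le_of_eq ?_))
      · exact ⟨hx.2, hx.1⟩
      · simp [ENNReal.zero_rpow_of_pos (hp.trans hpq)]
  rw [oscNorm, lintegral_congr_ae (g := fun _ => 0)]
  · simp [hs]
  · filter_upwards [h0] with x hx
    rw [hx, ENNReal.zero_rpow_of_pos hs]

lemma MemLpLoc.gradMeasure_ne_top (hg : MemLpLoc μ p g) (x : X) {ρ : ℝ} (hρ : 0 < ρ) :
    gradMeasure μ p g (ball x ρ) ≠ ∞ := by
  rw [gradMeasure_ball]
  exact (hg x ρ hρ).2.ne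

end

end TwoWeight

/-! ### Choice of constants and the two parts of the theorem -/

namespace TwoWeight

lemma exists_real_const {c₁ c₂ : ℝ≥0∞} (h₁ : c₁ ≠ ∞) (h₂ : c₂ ≠ ∞) :
    ∃ C : ℝ, 0 < C ∧ c₁ ≤ ENNReal.ofReal C ∧ c₂ ≤ ENNReal.ofReal C := by
  refine ⟨c₁.toReal + c₂.toReal + 1, by positivity, ?_, ?_⟩
  · refine ENNReal.le_ofReal_iff_toReal_le h₁ (by positivity) |>.2 ?_
    linarith [ENNReal.toReal_nonneg (a := c₂)]
  · refine ENNReal.le_ofReal_iff_toReal_le h₂ (by positivity) |>.2 ?_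
    linarith [ENNReal.toReal_nonneg (a := c₁)]

/-- A common doubling constant. -/
noncomputable def commonConst (Cμ Cν : ℝ) (N : ℕ) (D₀ : ℝ≥0∞) : ℝ≥0∞ :=
  1 + ENNReal.ofReal Cμ + ENNReal.ofReal Cμ ^ 2 + ENNReal.ofReal Cν ^ N + D₀

section

variable {Cμ Cν : ℝ} {N : ℕ} {D₀ : ℝ≥0∞}

lemma commonConst_ne_top (h : D₀ ≠ ∞) : commonConst Cμ Cν N D₀ ≠ ∞ := by
  simp [commonConst, h]

lemma le_commonConst : 1 ≤ commonConst Cμ Cν N D₀ ∧ ENNReal.ofReal Cμ ≤ commonConst Cμ Cν N D₀ ∧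
    ENNReal.ofReal Cμ ^ 2 ≤ commonConst Cμ Cν N D₀ ∧
    ENNReal.ofReal Cν ^ N ≤ commonConst Cμ Cν N D₀ ∧ D₀ ≤ commonConst Cμ Cν N D₀ := by
  simp only [commonConst]
  refine ⟨?_, ?_, ?_, ?_, le_add_self⟩
  · exact le_self_add.trans (le_self_add.trans (le_self_add.trans le_self_add))
  · exact le_add_self.trans (le_self_add.trans (le_self_add.trans le_self_add))
  · exact le_add_self.trans (le_self_add.trans le_self_add)
  · exact le_add_self.trans le_self_add

end

/-- The two-weighted Sobolev–Poincaré inequality at small scales, under the decay condition. -/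
theorem local_sobolev_poincare (p q α lam δ Cμ Cν Cδ CP : ℝ) (hp : 1 ≤ p) (hpq : p < q)
    (hα : 0 < α) (hlam : 1 ≤ lam) (hδ : 0 < δ) (hCμ : 0 < Cμ) (hCν : 0 < Cν) (hCδ : 0 < Cδ)
    (hCP : 0 < CP) :
    ∃ C : ℝ, 0 < C ∧
        ∀ (X : Type*) [MetricSpace X] [MeasurableSpace X] [OpensMeasurableSpace X]
          (μ ν : Measure X) (E : Set X) (r₀ : ℝ),
          NullMeasurableSet E ν → 0 < r₀ →
          (∀ x ∈ E, ∀ r : ℝ, 0 < r → r ≤ r₀ →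
            DoublingAt μ Cμ x r ∧ DoublingAt ν Cν x r) →
          (∀ x ∈ E, ∀ r' r : ℝ, 0 < r' → r' < r → r ≤ r₀ →
            ν (ball x r') / ν (ball x r) ≤ ENNReal.ofReal (Cδ * (r' / r) ^ δ)) →
          Theta μ ν E p q α lam r₀ < ∞ →
          ∀ (u : X → EReal) (g : X → ℝ≥0∞),
            MemL1Loc μ u → MemLpLoc μ p g →
            LebesguePoints μ ν E u →
            (∀ x ∈ E, ∀ r : ℝ, 0 < r → r ≤ r₀ →
              PoincareAt μ p α lam CP u g x r) →
            (∀ q' : ℝ, 1 ≤ q' → q' < q →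
              ∀ x ∈ E, ∀ r : ℝ, 0 < r → 10 * lam * r ≤ r₀ →
                oscNorm μ ν E q' u x r ≤
                    ENNReal.ofReal C * Theta μ ν E p q α lam r *
                      (ν (ball x r ∩ E) ^ (1 / q' - 1 / q) / ENNReal.ofReal (q - q')) *
                      gradNorm μ p g x (2 * lam * r) ∧
                  MemLpOn ν q' (ball x r ∩ E) u) ∧
            ((∀ x ∈ E, ∀ r : ℝ, 0 < r → r ≤ r₀ →
                TruncPoincareAt μ p α lam CP u g x r) →
              ∀ x ∈ E, ∀ r : ℝ, 0 < r → 10 * lam * r ≤ r₀ →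
                oscNorm μ ν E q u x r ≤
                    ENNReal.ofReal C * Theta μ ν E p q α lam r *
                      gradNorm μ p g x (2 * lam * r) ∧
                  MemLpOn ν q (ball x r ∩ E) u) := by
  have hp0 : 0 < p := by linarith
  have hq0 : 0 < q := by linarith
  obtain ⟨N, hN, hN'⟩ := exists_two_pow_enlargement hlam
  set D := commonConst Cμ Cν N (ENNReal.ofReal Cδ) with hD
  set θ := ENNReal.ofReal (2 ^ (-δ)) with hθdef
  have hDt : D ≠ ∞ := commonConst_ne_top ENNReal.ofReal_ne_top
  obtain ⟨hD1, hD2, hD3, hD4, hD5⟩ :=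
    le_commonConst (Cμ := Cμ) (Cν := Cν) (N := N) (D₀ := ENNReal.ofReal Cδ)
  have hθ : θ < 1 := by
    rw [hθdef, ← ENNReal.ofReal_one]
    exact (ENNReal.ofReal_lt_ofReal_iff one_pos).2
      (Real.rpow_lt_one_of_one_lt_of_neg one_lt_two (by linarith))
  have hA : ENNReal.ofReal (CP * 4 ^ α) ≠ ∞ := ENNReal.ofReal_ne_top
  have hw : weakConst D θ p q ^ (1 / q) ≠ ∞ :=
    ENNReal.rpow_ne_top_of_nonneg (by positivity) (weakConst_ne_top hDt hθ hp0 hpq)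
  have hs : strongConst D θ p q ^ (1 / q) ≠ ∞ :=
    ENNReal.rpow_ne_top_of_nonneg (by positivity) (strongConst_ne_top hDt hθ hp0 hpq)
  obtain ⟨C, hC, hC1, hC2⟩ := exists_real_const
    (ENNReal.mul_ne_top (ENNReal.mul_ne_top hw hA) (ENNReal.ofReal_ne_top (r := q)))
    (ENNReal.mul_ne_top hs hA)
  refine ⟨C, hC, ?_⟩
  intro X _ _ _ μ ν E r₀ hE hr₀ hdbl hdecay hΘ u g hu hg hL hP
  have hlocal : ∀ x ∈ E, ∀ r : ℝ, 0 < r → 10 * lam * r ≤ r₀ →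
      r ≤ r₀ ∧ 2 * r ≤ r₀ ∧ LocalDoubling μ ν E x r lam D θ := fun x hx r hr hrr => by
    have hlr : r ≤ lam * r := le_mul_of_one_le_left hr.le hlam
    have hrr₀ : r ≤ r₀ := by linarith
    exact ⟨hrr₀, by linarith, LocalDoubling.of_doubling hCμ hCν hr hlam hrr hN hN' hDt hD1 hD2 hD3
      hD4 hθ hx hdbl fun y hy i j => dyadic_decay_of_decay hCν hCδ hr hrr₀ hD1 hD5
        (fun ρ hρ hρr => (hdbl y hy ρ hρ hρr).2) (hdecay y hy) i j⟩
  have hfinS : ∀ x ∈ E, ∀ r : ℝ, 0 < r → r ≤ r₀ → ν (ball x r ∩ E) ≠ ∞ := fun x hx r hr hrr =>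
    ne_top_of_le_ne_top ((hdbl x hx r hr hrr).2.lt_top hCν).ne (measure_mono inter_subset_left)
  have hΘr : ∀ r ≤ r₀, Theta μ ν E p q α lam r ≠ ∞ := fun r hr =>
    ne_top_of_le_ne_top hΘ.ne (theta_mono subset_rfl hr)
  have hG : ∀ x, ∀ r : ℝ, 0 < r → gradNorm μ p g x (2 * lam * r) ≠ ∞ := fun x r hr => by
    rw [gradNorm_eq]
    exact ENNReal.rpow_ne_top_of_nonneg (by positivity) (hg.gradMeasure_ne_top x (by positivity))
  refine ⟨fun s hs1 hsq x hx r hr hrr => ?_, fun hT x hx r hr hrr => ?_⟩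
  · obtain ⟨hrr₀, h2r, h⟩ := hlocal x hx r hr hrr
    have hqs : 0 < q - s := by linarith
    have hexp : 0 < 1 / s - 1 / q := sub_pos.2 (one_div_lt_one_div_of_lt (by linarith) hsq)
    -- The argument yields the supremum over centres in E ∩ B; part 1 asks only for the larger one
    -- over E.
    have hTh : Theta μ ν (E ∩ ball x r) p q α lam r ≤ Theta μ ν E p q α lam r :=
      theta_mono inter_subset_left le_rfl
    have key := oscNorm_le_of_lt h hp0 hpq hs1 hsq
      (ENNReal.mul_ne_top hA (ne_top_of_le_ne_top (hΘr r hrr₀) hTh))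
      (OscBound.of_poincare h hp0 hα hCP (fun y _ ρ hρ _ => (hu y ρ hρ).integrableOn_toReal)
        (hu x (2 * r) (by linarith)).integrableOn_toReal
        (fun y hy ρ hρ hρr => hP y hy ρ hρ (hρr.trans h2r)))
      (hg.gradMeasure_ne_top x (by positivity)) hE hu hL
    have hbound : oscNorm μ ν E s u x r ≤
        ENNReal.ofReal C * Theta μ ν E p q α lam r *
          (ν (ball x r ∩ E) ^ (1 / s - 1 / q) / ENNReal.ofReal (q - s)) *
          gradNorm μ p g x (2 * lam * r) := by
      refine key.trans ?_
      rw [ENNReal.ofReal_div_of_pos hqs]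
      calc _ = weakConst D θ p q ^ (1 / q) * ENNReal.ofReal (CP * 4 ^ α) * ENNReal.ofReal q *
            Theta μ ν (E ∩ ball x r) p q α lam r *
            (ν (ball x r ∩ E) ^ (1 / s - 1 / q) / ENNReal.ofReal (q - s)) *
            gradNorm μ p g x (2 * lam * r) := by
            rw [ENNReal.div_eq_inv_mul, ENNReal.div_eq_inv_mul]; ring
        _ ≤ _ := by gcongr
    refine ⟨hbound, memLpOn_of_oscNorm_lt_top hs1 (aemeasurable_of_lebesguePoints hu hL hE hr)
      (hfinS x hx r hr hrr₀) (hbound.trans_lt (lt_top_iff_ne_top.2 ?_))⟩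
    exact ENNReal.mul_ne_top (ENNReal.mul_ne_top (ENNReal.mul_ne_top ENNReal.ofReal_ne_top
      (hΘr r hrr₀)) (ENNReal.div_ne_top
        (ENNReal.rpow_ne_top_of_nonneg hexp.le (hfinS x hx r hr hrr₀)) (by simpa using hqs)))
      (hG x r hr)
  · obtain ⟨hrr₀, h2r, h⟩ := hlocal x hx r hr hrr
    have hTh : Theta μ ν (E ∩ ball x r) p q α lam r ≤ Theta μ ν E p q α lam r :=
      theta_mono inter_subset_left le_rfl
    have key := oscNorm_le_of_truncPoincare h hp0 hpq hα hCP
      (ne_top_of_le_ne_top (hΘr r hrr₀) hTh)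
      (fun y hy ρ hρ hρr => hP y hy ρ hρ (hρr.trans h2r))
      (fun y hy ρ hρ hρr => hT y hy ρ hρ (hρr.trans h2r))
      (hg.gradMeasure_ne_top x (by positivity)) hE hu hg hL
    have hbound : oscNorm μ ν E q u x r ≤
        ENNReal.ofReal C * Theta μ ν E p q α lam r * gradNorm μ p g x (2 * lam * r) := by
      refine key.trans ?_
      rw [← mul_assoc]
      gcongr
    exact ⟨hbound, memLpOn_of_oscNorm_lt_top (by linarith)
      (aemeasurable_of_lebesguePoints hu hL hE hr) (hfinS x hx r hr hrr₀)
      (hbound.trans_lt (lt_top_iff_ne_top.2 (ENNReal.mul_ne_top (ENNReal.mul_ne_top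
        ENNReal.ofReal_ne_top (hΘr r hrr₀)) (hG x r hr))))⟩

/-- The theorem on uniformly perfect sets, at all scales. -/
theorem global_sobolev_poincare (p q q' α lam a Cμ Cν CP : ℝ) (hp : 1 ≤ p) (hpq : p < q)
    (hq'1 : 1 ≤ q') (hq'q : q' ≤ q) (hα : 0 < α) (hlam : 1 ≤ lam) (ha : 0 < a) (ha1 : a < 1)
    (hCμ : 0 < Cμ) (hCν : 0 < Cν) (hCP : 0 < CP) :
      ∃ C' : ℝ, 0 < C' ∧
        ∀ (X : Type*) [MetricSpace X] [MeasurableSpace X] [OpensMeasurableSpace X]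
          (μ ν : Measure X) (E : Set X),
          NullMeasurableSet E ν → UniformlyPerfect E a →
          (∀ x ∈ E, ∀ r : ℝ, 0 < r →
            DoublingAt μ Cμ x r ∧ DoublingAt ν Cν x r) →
          ∀ (u : X → EReal) (g : X → ℝ≥0∞),
            MemL1Loc μ u → MemLpLoc μ p g →
            LebesguePoints μ ν E u →
            (∀ x ∈ E, ∀ r : ℝ, 0 < r → PoincareAt μ p α lam CP u g x r) →
            (q' < q ∨
              ∀ x ∈ E, ∀ r : ℝ, 0 < r → TruncPoincareAt μ p α lam CP u g x r) →
            ∀ x ∈ E, ∀ r : ℝ, 0 < r →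
              oscNorm μ ν E q' u x r ≤
                ENNReal.ofReal C' * ν (ball x r ∩ E) ^ (1 / q' - 1 / q) *
                  Theta μ ν (E ∩ ball x r) p q α lam r *
                  gradNorm μ p g x (2 * lam * r) := by
  have hp0 : 0 < p := by linarith
  have hq0 : 0 < q := by linarith
  have hq'0 : 0 < q' := by linarith
  obtain ⟨N, hN, hN'⟩ := exists_two_pow_enlargement hlam
  obtain ⟨m, hm⟩ : ∃ m : ℕ, 8 ≤ 2 ^ m * a := by
    obtain ⟨m, hm⟩ := pow_unbounded_of_one_lt (8 / a) one_lt_two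
    exact ⟨m, ((div_lt_iff₀ ha).1 hm).le⟩
  have hm0 : 0 < m := by
    refine Nat.pos_of_ne_zero fun h => ?_
    rw [h, pow_zero] at hm
    linarith
  set γ : ℝ≥0∞ := 1 - (2 * (1 + ENNReal.ofReal Cν) ^ m)⁻¹ with hγ
  have hGt : 2 * (1 + ENNReal.ofReal Cν) ^ m ≠ ∞ :=
    ENNReal.mul_ne_top (by simp) (ENNReal.pow_ne_top (by simp))
  -- The factor 2 makes this strict, hence γ > 0 and γ⁻¹ an admissible finite constant.
  have hG1 : (1 : ℝ≥0∞) < 2 * (1 + ENNReal.ofReal Cν) ^ m := by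
    have : (1 : ℝ≥0∞) ≤ (1 + ENNReal.ofReal Cν) ^ m := one_le_pow₀ le_self_add
    calc (1 : ℝ≥0∞) < 2 * 1 := by norm_num
      _ ≤ _ := by gcongr
  have hγ0 : γ ≠ 0 := (tsub_pos_of_lt (ENNReal.inv_lt_one.2 hG1)).ne'
  have hγ1 : γ < 1 := ENNReal.sub_lt_self (by simp) (by simp) (ENNReal.inv_ne_zero.2 hGt)
  set D := commonConst Cμ Cν N γ⁻¹ with hD
  set θ := γ ^ (1 / (m : ℝ)) with hθdef
  have hDt : D ≠ ∞ := commonConst_ne_top (ENNReal.inv_ne_top.2 hγ0)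
  obtain ⟨hD1, hD2, hD3, hD4, hD5⟩ := le_commonConst (Cμ := Cμ) (Cν := Cν) (N := N) (D₀ := γ⁻¹)
  have hθ : θ < 1 := ENNReal.rpow_lt_one hγ1 (by positivity)
  have hA : ENNReal.ofReal (CP * 4 ^ α) ≠ ∞ := ENNReal.ofReal_ne_top
  have hw : weakConst D θ p q ^ (1 / q) ≠ ∞ :=
    ENNReal.rpow_ne_top_of_nonneg (by positivity) (weakConst_ne_top hDt hθ hp0 hpq)
  have hs : strongConst D θ p q ^ (1 / q) ≠ ∞ :=
    ENNReal.rpow_ne_top_of_nonneg (by positivity) (strongConst_ne_top hDt hθ hp0 hpq)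
  -- For q' = q the quotient q/(q - q') is 0 by the convention for division; only the second bound
  -- is then used.
  obtain ⟨C, hC, hC1, hC2⟩ := exists_real_const
    (ENNReal.mul_ne_top (ENNReal.mul_ne_top hw hA) (ENNReal.ofReal_ne_top (r := q / (q - q'))))
    (ENNReal.mul_ne_top hs hA)
  refine ⟨C, hC, ?_⟩
  intro X _ _ _ μ ν E hE hperf hdbl u g hu hg hL hP hcase x hx r hr
  have hR : 0 < 2 * lam * r := by positivity
  have h : LocalDoubling μ ν E x r lam D θ :=
    -- Doubling holds at all radii, so the scale r₀ may be adapted to the ball.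
    LocalDoubling.of_doubling (r₀ := 10 * lam * r) hCμ hCν hr hlam le_rfl hN hN' hDt hD1 hD2 hD3
      hD4 hθ hx (fun y hy ρ hρ _ => hdbl y hy ρ hρ) fun y hy i j =>
      (dyadic_decay_of_reverse_doubling hm0 hγ0 hγ1.le
        (fun ρ hρ => reverse_doubling_of_uniformlyPerfect ha ha1 hCν hperf
          (fun z hz ρ hρ => (hdbl z hz ρ hρ).2) hm (by linarith) hy hρ) hr i j).trans (by gcongr)
  have hκ := hg.gradMeasure_ne_top x hR
  have hint : ∀ y ∈ ball x r ∩ E, ∀ ρ : ℝ, 0 < ρ → ρ ≤ r →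
      IntegrableOn (fun y => (u y).toReal) (ball y ρ) μ :=
    fun y _ ρ hρ _ => (hu y ρ hρ).integrableOn_toReal
  have hint₂ := (hu x (2 * r) (by linarith)).integrableOn_toReal
  -- Since Θ may be infinite, a vanishing gradient norm or a null B ∩ E makes the right-hand side 0
  -- and the left-hand side must be shown to vanish. Outside these two cases Θ = ∞ makes the
  -- right-hand side infinite.
  rcases eq_or_ne (gradMeasure μ p g (ball x (2 * lam * r))) 0 with hκ0 | hκ0
  · rw [oscNorm_eq_zero_of_oscBound_zero h hp0 hpq hq'0
      (OscBound.of_gradMeasure_eq_zero h hp0 hint hint₂ (fun y hy ρ hρ _ => hP y hy ρ hρ) hκ0)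
      hκ hE hL]
    exact zero_le
  have hexp : 0 ≤ 1 / q' - 1 / q := sub_nonneg.2 (one_div_le_one_div_of_le hq'0 hq'q)
  rcases eq_or_ne (ν (ball x r ∩ E)) 0 with hν0 | hν0
  · rw [oscNorm_eq_zero_of_measure_zero hq'0 hν0]
    exact zero_le
  have hνt : ν (ball x r ∩ E) ≠ ∞ :=
    ne_top_of_le_ne_top ((hdbl x hx r hr).2.lt_top hCν).ne (measure_mono inter_subset_left)
  rcases eq_or_ne (Theta μ ν (E ∩ ball x r) p q α lam r) ∞ with hΘ | hΘ
  · have h1 : ENNReal.ofReal C * ν (ball x r ∩ E) ^ (1 / q' - 1 / q) ≠ 0 :=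
      mul_ne_zero (by simpa using hC) (by simp [hν0, hνt])
    have h2 : gradNorm μ p g x (2 * lam * r) ≠ 0 := by
      rw [gradNorm_eq]
      simp [hκ0, hκ]
    rw [hΘ, ENNReal.mul_top h1, ENNReal.top_mul h2]
    exact le_top
  · rcases hq'q.lt_or_eq with hlt | rfl
    · refine (oscNorm_le_of_lt h hp0 hpq hq'1 hlt (ENNReal.mul_ne_top hA hΘ)
        (OscBound.of_poincare h hp0 hα hCP hint hint₂ (fun y hy ρ hρ _ => hP y hy ρ hρ))
        hκ hE hu hL).trans ?_
      calc _ = weakConst D θ p q ^ (1 / q) * ENNReal.ofReal (CP * 4 ^ α) *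
            ENNReal.ofReal (q / (q - q')) * ν (ball x r ∩ E) ^ (1 / q' - 1 / q) *
            Theta μ ν (E ∩ ball x r) p q α lam r * gradNorm μ p g x (2 * lam * r) := by ring
        _ ≤ _ := by gcongr
    · have hT := hcase.resolve_left (lt_irrefl _)
      refine (oscNorm_le_of_truncPoincare h hp0 hpq hα hCP hΘ (fun y hy ρ hρ _ => hP y hy ρ hρ)
        (fun y hy ρ hρ _ => hT y hy ρ hρ) hκ hE hu hg hL).trans ?_
      rw [sub_self, ENNReal.rpow_zero, mul_one, ← mul_assoc]
      gcongr

end TwoWeight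

theorem mainTheorem1 :
    (∀ p q α lam δ Cμ Cν Cδ CP : ℝ, 1 ≤ p → p < q → 0 < α → 1 ≤ lam → 0 < δ →
      0 < Cμ → 0 < Cν → 0 < Cδ → 0 < CP →
      ∃ C : ℝ, 0 < C ∧
        ∀ (X : Type*) [MetricSpace X] [MeasurableSpace X] [OpensMeasurableSpace X]
          (μ ν : Measure X) (E : Set X) (r₀ : ℝ),
          NullMeasurableSet E ν → 0 < r₀ →
          (∀ x ∈ E, ∀ r : ℝ, 0 < r → r ≤ r₀ →
            TwoWeight.DoublingAt μ Cμ x r ∧ TwoWeight.DoublingAt ν Cν x r) →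
          (∀ x ∈ E, ∀ r' r : ℝ, 0 < r' → r' < r → r ≤ r₀ →
            ν (ball x r') / ν (ball x r) ≤ ENNReal.ofReal (Cδ * (r' / r) ^ δ)) →
          TwoWeight.Theta μ ν E p q α lam r₀ < ∞ →
          ∀ (u : X → EReal) (g : X → ℝ≥0∞),
            TwoWeight.MemL1Loc μ u → TwoWeight.MemLpLoc μ p g →
            TwoWeight.LebesguePoints μ ν E u →
            (∀ x ∈ E, ∀ r : ℝ, 0 < r → r ≤ r₀ →
              TwoWeight.PoincareAt μ p α lam CP u g x r) →
            (∀ q' : ℝ, 1 ≤ q' → q' < q →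
              ∀ x ∈ E, ∀ r : ℝ, 0 < r → 10 * lam * r ≤ r₀ →
                TwoWeight.oscNorm μ ν E q' u x r ≤
                    ENNReal.ofReal C * TwoWeight.Theta μ ν E p q α lam r *
                      (ν (ball x r ∩ E) ^ (1 / q' - 1 / q) / ENNReal.ofReal (q - q')) *
                      TwoWeight.gradNorm μ p g x (2 * lam * r) ∧
                  TwoWeight.MemLpOn ν q' (ball x r ∩ E) u) ∧
            ((∀ x ∈ E, ∀ r : ℝ, 0 < r → r ≤ r₀ →
                TwoWeight.TruncPoincareAt μ p α lam CP u g x r) →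
              ∀ x ∈ E, ∀ r : ℝ, 0 < r → 10 * lam * r ≤ r₀ →
                TwoWeight.oscNorm μ ν E q u x r ≤
                    ENNReal.ofReal C * TwoWeight.Theta μ ν E p q α lam r *
                      TwoWeight.gradNorm μ p g x (2 * lam * r) ∧
                  TwoWeight.MemLpOn ν q (ball x r ∩ E) u)) ∧
    (∀ p q q' α lam a Cμ Cν CP : ℝ, 1 ≤ p → p < q → 1 ≤ q' → q' ≤ q → 0 < α → 1 ≤ lam →
      0 < a → a < 1 → 0 < Cμ → 0 < Cν → 0 < CP →
      ∃ C' : ℝ, 0 < C' ∧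
        ∀ (X : Type*) [MetricSpace X] [MeasurableSpace X] [OpensMeasurableSpace X]
          (μ ν : Measure X) (E : Set X),
          NullMeasurableSet E ν → TwoWeight.UniformlyPerfect E a →
          (∀ x ∈ E, ∀ r : ℝ, 0 < r →
            TwoWeight.DoublingAt μ Cμ x r ∧ TwoWeight.DoublingAt ν Cν x r) →
          ∀ (u : X → EReal) (g : X → ℝ≥0∞),
            TwoWeight.MemL1Loc μ u → TwoWeight.MemLpLoc μ p g →
            TwoWeight.LebesguePoints μ ν E u →
            (∀ x ∈ E, ∀ r : ℝ, 0 < r → TwoWeight.PoincareAt μ p α lam CP u g x r) →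
            (q' < q ∨
              ∀ x ∈ E, ∀ r : ℝ, 0 < r → TwoWeight.TruncPoincareAt μ p α lam CP u g x r) →
            ∀ x ∈ E, ∀ r : ℝ, 0 < r →
              TwoWeight.oscNorm μ ν E q' u x r ≤
                ENNReal.ofReal C' * ν (ball x r ∩ E) ^ (1 / q' - 1 / q) *
                  TwoWeight.Theta μ ν (E ∩ ball x r) p q α lam r *
                  TwoWeight.gradNorm μ p g x (2 * lam * r)) := by
  refine ⟨fun p q α lam δ Cμ Cν Cδ CP hp hpq hα hlam hδ hCμ hCν hCδ hCP =>
    TwoWeight.local_sobolev_poincare p q α lam δ Cμ Cν Cδ CP hp hpq hα hlam hδ hCμ hCν hCδ hCP,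
    fun p q q' α lam a Cμ Cν CP hp hpq hq'1 hq'q hα hlam ha ha1 hCμ hCν hCP =>
    TwoWeight.global_sobolev_poincare p q q' α lam a Cμ Cν CP hp hpq hq'1 hq'q hα hlam ha ha1
      hCμ hCν hCP⟩
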